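/- An $\infty$-cosmos is a simplicially enriched category $\mathcal K$ whose functor spaces $\mathrm{Fun}_{\mathcal K}(A,B)$ are quasi-categories, with a specified subcategory of isofibrations, such that: (a) as a simplicially enriched category, $\mathcal K$ has a terminal object $1$, small products, cotensors $A^U$ by small simplicial sets $U$, limits of countable inverse sequences of isofibrations, and pullbacks of isofibrations along arbitrary functors (these are the cosmological limits); (b) isofibrations contain the isomorphisms and the maps $A\to 1$, are stable under pullback, and are closed under limits of countable inverse sequences; for every isofibration $p\colon E\to B$ and every inclusion of simplicial sets $U\hookrightarrow V$ the induced map $E^V\to E^U\times_{B^U}B^V$ is an isofibration; and $\mathrm{Fun}_{\mathcal K}(X,p)$ is an isofibration of quasi-categories for every object $X$ and isofibration $p$. A functor $f$ is an equivalence if $\mathrm{Fun}_{\mathcal K}(X,f)$ is an equivalence of quasi-categories for all $X$, and a trivial fibration if it is both an isofibration and an equivalence. The homotopy 2-category $h_*\mathcal K$ is obtained by replacing each functor space by its homotopy category $h\mathrm{Fun}_{\mathcal K}(A,B)$. Let $\mathcal K$ be an $\infty$-cosmos. 1. For any object $E$ of $\mathcal K$ the following are equivalent; $E$ is called groupoidal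 if they hold: (i) every 2-cell with codomain $E$ in $h_*\mathcal K$ is invertible; (ii) for each $X\in\mathcal K$ the hom-category $h\mathrm{Fun}_{\mathcal K}(X,E)$ is a groupoid; (iii) for each $X\in\mathcal K$ the functor space $\mathrm{Fun}_{\mathcal K}(X,E)$ is a Kan complex; (iv) the isofibration $E^{\mathbb I}\to E^{\mathbb 2}$ induced by the inclusion $\mathbb 2\hookrightarrow\mathbb I$ of the walking arrow into the walking isomorphism is a trivial fibration. 2. The full simplicial subcategory $\mathcal K^{\mathrm{gr}}\hookrightarrow\mathcal K$ of groupoidal objects is an $\infty$-cosmos, with cosmological limits, isofibrations, equivalences and trivial fibrations created by the inclusion. (For limits this means: a limit in $\mathcal K$ of a cosmological diagram of groupoidal objects is groupoidal, and a cone in $\mathcal K^{\mathrm{gr}}$ over such a diagram is a limit cone in $\mathcal K^{\mathrm{gr}}$ if and only if it is one in $\mathcal K$, and likewise for cotensors. For the classes of maps: a functor between groupoidal objects belongs to the class in $\mathcal K^{\mathrm{gr}}$ if and only if it does in $\mathcal K$.) Moreover, all functor spaces of $\mathcal K^{\mathrm{gr}}$ are Kan complexes. -/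

import Mathlib

open CategoryTheory Category Limits MonoidalCategory Simplicial Opposite
open CategoryTheory.SimplicialCategory

universe v u

namespace InfCosmos

/-! ### Quasi-categories: isofibrations and equivalences -/

/-- The inclusion of the walking arrow into the walking isomorphism (both as nerves). -/
def arrowToIso : (Δ[1] : SSet.{v}) ⟶ SSet.coherentIso.{v} :=
  SSet.yonedaEquiv.symm SSet.coherentIso.hom.edge

/-- Isofibrations of quasi-categories: inner fibrations with the right lifting property against
the inclusion of either endpoint into the walking isomorphism. -/
structure IsQCatIsofibration {A B : SSet.{v}} (p : A ⟶ B) : Prop where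
  inner : SSet.innerFibrations p
  lift_zero : HasLiftingProperty
    (SSet.yonedaEquiv.symm SSet.coherentIso.x₀ : Δ[0] ⟶ SSet.coherentIso.{v}) p
  lift_one : HasLiftingProperty
    (SSet.yonedaEquiv.symm SSet.coherentIso.x₁ : Δ[0] ⟶ SSet.coherentIso.{v}) p

/-- The map `A ⟶ A × 𝕀` at a vertex of the walking isomorphism `𝕀`. -/
noncomputable def atVertex (A : SSet.{v}) (x : SSet.coherentIso.{v} _⦋0⦌) :
    A ⟶ A ⊗ SSet.coherentIso.{v} :=
  CartesianMonoidalCategory.lift (𝟙 A) (SSet.const x)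

/-- `f` and `g` are joined by a homotopy `A × 𝕀 ⟶ B`, equivalently a map `A ⟶ B ^ 𝕀`,
parametrised by the walking isomorphism `𝕀`. -/
def IsoHomotopic {A B : SSet.{v}} (f g : A ⟶ B) : Prop :=
  ∃ H : A ⊗ SSet.coherentIso.{v} ⟶ B,
    atVertex A SSet.coherentIso.x₀ ≫ H = f ∧ atVertex A SSet.coherentIso.x₁ ≫ H = g

/-- Equivalences of quasi-categories. -/
def IsQCatEquivalence {A B : SSet.{v}} (f : A ⟶ B) : Prop :=
  ∃ g : B ⟶ A, IsoHomotopic (𝟙 A) (f ≫ g) ∧ IsoHomotopic (g ≫ f) (𝟙 B)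

/-! ### Simplicially enriched limits -/

section

variable {K : Type u} [Category.{v} K] [SimplicialCategory K]

/-- A cone is a simplicially enriched (conical) limit cone if it is a limit cone in the underlying
category which each functor space functor `Fun(X, -)` carries to a limit cone of simplicial sets. -/
structure IsConicalLimit {J : Type*} [Category* J] {D : J ⥤ K} (c : Cone D) : Prop where
  isLimit : Nonempty (IsLimit c)
  isLimit_sHom (X : K) : Nonempty (IsLimit ((eCoyoneda SSet.{v} X).mapCone c))

/-- Given `η : U ⟶ Fun(P, A)`, the induced comparison map `Fun(X, P) ⟶ Fun(X, A) ^ U`. -/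
noncomputable def cotensorComparison {U : SSet.{v}} {A P : K} (η : U ⟶ sHom P A) (X : K) :
    sHom X P ⟶ (ihom U).obj (sHom X A) :=
  MonoidalClosed.curry ((β_ U (sHom X P)).hom ≫ sHom X P ◁ η ≫ sHomComp X P A)

/-- `η : U ⟶ Fun(P, A)` exhibits `P` as the simplicial cotensor `A ^ U`: it induces isomorphisms
`Fun(X, P) ≅ Fun(X, A) ^ U` of simplicial sets. -/
def IsCotensor {U : SSet.{v}} {A P : K} (η : U ⟶ sHom P A) : Prop :=
  ∀ X : K, IsIso (cotensorComparison η X)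

/-- The functor `X ⟶ A ^ U` which corresponds to `θ : U ⟶ Fun(X, A)`. -/
noncomputable def IsCotensor.lift {U : SSet.{v}} {A P X : K} {η : U ⟶ sHom P A}
    (h : IsCotensor η) (θ : U ⟶ sHom X A) : X ⟶ P :=
  haveI := h X
  (eHomEquiv SSet.{v}).symm
    (MonoidalClosed.curry ((ρ_ U).hom ≫ θ) ≫ inv (cotensorComparison η X))

lemma comp_cotensorComparison_eq_iff {U : SSet.{v}} {A P X : K} (η : U ⟶ sHom P A) (f : X ⟶ P)
    (θ : U ⟶ sHom X A) :
    eHomEquiv SSet.{v} f ≫ cotensorComparison η X = MonoidalClosed.curry ((ρ_ U).hom ≫ θ) ↔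
      η ≫ eHomWhiskerRight SSet.{v} f A = θ := by
  rw [cotensorComparison, ← MonoidalClosed.curry_natural_left,
    (MonoidalClosed.curry_injective).eq_iff]
  have : U ◁ eHomEquiv SSet.{v} f ≫ (β_ U (sHom X P)).hom ≫ sHom X P ◁ η ≫ sHomComp X P A =
      (ρ_ U).hom ≫ η ≫ eHomWhiskerRight SSet.{v} f A := by
    rw [BraidedCategory.braiding_naturality_right_assoc, ← whisker_exchange_assoc,
      eHomWhiskerRight]
    simp
  rw [this, cancel_epi]

/-- `h.lift θ` is the functor that carries the universal `η` to `θ`. -/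
lemma IsCotensor.lift_spec {U : SSet.{v}} {A P X : K} {η : U ⟶ sHom P A}
    (h : IsCotensor η) (θ : U ⟶ sHom X A) :
    η ≫ eHomWhiskerRight SSet.{v} (h.lift θ) A = θ := by
  have := h X
  rw [← comp_cotensorComparison_eq_iff]
  simp [IsCotensor.lift]

lemma IsCotensor.eq_lift {U : SSet.{v}} {A P X : K} {η : U ⟶ sHom P A}
    (h : IsCotensor η) (θ : U ⟶ sHom X A) (f : X ⟶ P)
    (hf : η ≫ eHomWhiskerRight SSet.{v} f A = θ) : f = h.lift θ := by
  have := h X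
  rw [← comp_cotensorComparison_eq_iff] at hf
  simp [IsCotensor.lift, ← hf]

/-- The functor `A ^ V ⟶ B ^ U` induced by `i : U ⟶ V` and `f : A ⟶ B`. -/
noncomputable def IsCotensor.map {U V : SSet.{v}} {A B P Q : K}
    {η : V ⟶ sHom P A} (_hη : IsCotensor η) {θ : U ⟶ sHom Q B} (hθ : IsCotensor θ)
    (i : U ⟶ V) (f : A ⟶ B) : P ⟶ Q :=
  hθ.lift (i ≫ η ≫ eHomWhiskerLeft SSet.{v} P f)

/-- Representably defined equivalences. -/
def IsEquivalence {A B : K} (f : A ⟶ B) : Prop :=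
  ∀ X : K, IsQCatEquivalence (eHomWhiskerLeft SSet.{v} X f)

/-- Trivial fibrations: isofibrations that are equivalences. -/
def IsTrivialFibration (isofib : MorphismProperty K) {A B : K} (f : A ⟶ B) : Prop :=
  isofib f ∧ IsEquivalence f

/-- A countable inverse sequence `⋯ ⟶ D 2 ⟶ D 1 ⟶ D 0` of isofibrations. -/
def IsTower (isofib : MorphismProperty K) (D : ℕᵒᵖ ⥤ K) : Prop :=
  ∀ n : ℕ, isofib (D.map (homOfLE n.le_succ).op)

end

/-! ### ∞-cosmoi -/

/-- A simplicially enriched category `K` with a specified class of isofibrations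
is an ∞-cosmos. -/
structure IsInfinityCosmos (K : Type u) [Category.{v} K] [SimplicialCategory K]
    (isofib : MorphismProperty K) : Prop where
  /-- the functor spaces are quasi-categories -/
  quasicategory (A B : K) : SSet.Quasicategory (sHom A B)
  /-- the isofibrations form a subcategory (containing all objects) -/
  isMultiplicative : isofib.IsMultiplicative
  /-- completeness: terminal object, small products, cotensors, limits of towers of isofibrations,
  pullbacks of isofibrations along any functor -/
  exists_terminal : ∃ T : K, IsConicalLimit (asEmptyCone T)
  exists_product {I : Type v} (A : I → K) : ∃ c : Fan A, IsConicalLimit c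
  exists_cotensor (A : K) (U : SSet.{v}) : ∃ (P : K) (η : U ⟶ sHom P A), IsCotensor η
  exists_towerLimit (D : ℕᵒᵖ ⥤ K) (_ : IsTower isofib D) : ∃ c : Cone D, IsConicalLimit c
  exists_pullback {A B E : K} (f : A ⟶ B) (p : E ⟶ B) (_ : isofib p) :
    ∃ c : PullbackCone f p, IsConicalLimit c
  /-- isofibrations: isomorphisms, maps to terminal objects, pullbacks, limits of towers,
  Leibniz cotensors -/
  isofib_of_isIso {A B : K} (f : A ⟶ B) [IsIso f] : isofib f
  isofib_to_terminal {A T : K} (_ : IsConicalLimit (asEmptyCone T)) (f : A ⟶ T) : isofib f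
  isofib_pullback {A B E : K} {f : A ⟶ B} {p : E ⟶ B} (c : PullbackCone f p)
    (_ : IsConicalLimit c) (_ : isofib p) : isofib c.fst
  isofib_towerLimit {D : ℕᵒᵖ ⥤ K} (_ : IsTower isofib D) (c : Cone D) (_ : IsConicalLimit c)
    (n : ℕ) : isofib (c.π.app (op n))
  /-- for an isofibration `p : E ⟶ B` and an inclusion `i : U ⟶ V`, the induced map `m` from `E ^ V`
  to the pullback `c` of `E ^ U ⟶ B ^ U` along `B ^ V ⟶ B ^ U` is an isofibration -/
  isofib_leibniz {E B : K} (p : E ⟶ B) (_ : isofib p) {U V : SSet.{v}} (i : U ⟶ V) [Mono i]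
    {EV EU BV BU : K}
    {ηEV : V ⟶ sHom EV E} {ηEU : U ⟶ sHom EU E} {ηBV : V ⟶ sHom BV B} {ηBU : U ⟶ sHom BU B}
    (hEV : IsCotensor ηEV) (hEU : IsCotensor ηEU) (hBV : IsCotensor ηBV) (hBU : IsCotensor ηBU)
    (c : PullbackCone (hBV.map hBU i (𝟙 B)) (hEU.map hBU (𝟙 U) p)) (_ : IsConicalLimit c)
    (m : EV ⟶ c.pt) (_ : m ≫ c.fst = hEV.map hBV (𝟙 V) p) (_ : m ≫ c.snd = hEV.map hEU i (𝟙 E)) :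
    isofib m
  /-- isofibrations are representably isofibrations of quasi-categories -/
  isofib_sHom (X : K) {E B : K} (p : E ⟶ B) (_ : isofib p) :
    IsQCatIsofibration (eHomWhiskerLeft SSet.{v} X p)

/-! ### The homotopy 2-category and groupoidal objects -/

section

variable (K : Type u) [Category.{v} K] [SimplicialCategory K]

/-- Applying the homotopy category functor to all functor spaces gives a `Cat`-enrichment. -/
noncomputable instance instHomotopyEnrichment : EnrichedOrdinaryCategory Cat.{v, v}
    (TransportEnrichment SSet.hoFunctor.{v} K) :=
  TransportEnrichment.enrichedOrdinaryCategory K SSet.hoFunctor.{v}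
    (SSet.hoFunctor.unitHomEquiv · |>.trans <| Functor.equivCatHom _ _)
    (congrArg (Functor.toCatHom) <| SSet.hoFunctor.unitHomEquiv_eq · ·)

/-- The homotopy 2-category: the strict 2-category with the objects and 1-cells of `K` and with
2-cells those of the homotopy categories of the functor spaces. -/
abbrev HomotopyTwoCategory : Type u := CatEnrichedOrdinary (TransportEnrichment SSet.hoFunctor.{v} K)

/-- An object `E` of a 2-category is groupoidal if every 2-cell with codomain `E` is invertible. -/
def IsGroupoidalInBicategory {B : Type*} [Bicategory B] (E : B) : Prop :=
  ∀ (X : B) (f g : X ⟶ E) (α : f ⟶ g), IsIso α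

/-- An object of `K` is groupoidal if it is groupoidal in the homotopy 2-category. -/
def IsGroupoidal : ObjectProperty K := fun E ↦
  IsGroupoidalInBicategory (B := HomotopyTwoCategory.{v} K) E

/-- The full simplicial subcategory of groupoidal objects. -/
abbrev GroupoidalObjects : Type u := (IsGroupoidal K).FullSubcategory

end

/-! ### Creation of limits by a full simplicial subcategory -/

section

variable {K : Type u} [Category.{v} K] [SimplicialCategory K] (P : ObjectProperty K)

/-- The inclusion of `P` creates the conical limits of `D`: limit cones in `K` over the image
of `D` lie in the full subcategory (so that they lift, uniquely), and a cone in the full subcategory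
is a limit cone if and only if it is one in `K`. -/
def CreatesConicalLimit {J : Type*} [Category* J] (D : J ⥤ P.FullSubcategory) : Prop :=
  (∀ c : Cone (D ⋙ P.ι), IsConicalLimit c → P c.pt) ∧
    ∀ c : Cone D, IsConicalLimit c ↔ IsConicalLimit (P.ι.mapCone c)

/-- The inclusion of `P` creates the cotensor of `A` by `U`. The functor spaces of the full
subcategory are those of `K`. -/
def CreatesCotensor (A : P.FullSubcategory) (U : SSet.{v}) : Prop :=
  (∀ (Q : K) (η : U ⟶ sHom Q A.obj), IsCotensor η → P Q) ∧
    ∀ (Q : P.FullSubcategory) (η : U ⟶ sHom Q A),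
      IsCotensor η ↔ IsCotensor (A := A.obj) (P := Q.obj) η

/-- The inclusion of `P` creates all cosmological limits. -/
structure CreatesCosmologicalLimits (isofib : MorphismProperty K) : Prop where
  terminal (D : Discrete PEmpty.{1} ⥤ P.FullSubcategory) : CreatesConicalLimit P D
  product {I : Type v} (A : I → P.FullSubcategory) : CreatesConicalLimit P (Discrete.functor A)
  cotensor (A : P.FullSubcategory) (U : SSet.{v}) : CreatesCotensor P A U
  towerLimit (D : ℕᵒᵖ ⥤ P.FullSubcategory) (_ : IsTower isofib (D ⋙ P.ι)) : CreatesConicalLimit P D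
  pullback {A B E : P.FullSubcategory} (f : A ⟶ B) (p : E ⟶ B) (_ : isofib (P.ι.map p)) :
    CreatesConicalLimit P (cospan f p)

end

end InfCosmos

namespace InfCosmos

/-! ### Subcomplexes of a standard simplex as families of faces -/

/-! Conditions (i) and (ii) are the same statement read in the homotopy 2-category. The equivalence
of (ii) and (iii) is Joyal's theorem: a quasi-category is a Kan complex exactly when its homotopy
category is a groupoid. The substance is `exists_lift_horn_zero`, which lifts outer horns at `0`
against an inner fibration `p : E ⟶ B` over a quasi-category when every edge of `E` has a one-sided
inverse; duality gives the horns at the last vertex.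

To lift a horn of `Δ[k + 2]` at `0`, replace its first edge `e` by a zigzag in `Δ[k + 4]`. The
vertices `0, 2` collapse to `0`, the vertices `1, 3` to `1`, and the vertices from `4` on (the tail)
are those from `2` on. The edge `2 → 3` carries `e`, the edge `1 → 2` an inverse `v` of `e`, and the
edge `0 → 1` an inverse of `v`. Inner horns then suffice. They first yield a lift on `1` and the
tail, which is the facet that the horn lacks, and then on `0, 3` and the tail, which is the required
simplex. Subcomplexes of `Δ[k + 4]` are handled as down-closed families of vertex sets, and
`innerAnodyne_of_cone` recognises inner anodyne inclusions by pairing the missing faces through an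
interior vertex.

For (iii) and (iv), the inclusion of the walking arrow into the walking isomorphism is anodyne
(`anodyneExtensions_arrowToIso`). If `Q` is a Kan complex, `Q ^ 𝕀 ⟶ Q ^ 𝟚` therefore lifts against
all monomorphisms. Conversely, an isofibration that is an equivalence is surjective on vertices, so
(iv) makes every arrow extend to `𝕀`.

For the second part, an isofibration between Kan complexes is a Kan fibration
(`fibration_of_isQCatIsofibration`), so condition (iii) passes to cosmological limits; limits and
cotensors in a full simplicial subcategory are then compared with those in `K` by uniqueness.
Equivalences need an argument, since the subcategory has fewer test objects: by Yoneda, testing on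
the source and the target is enough (`isEquivalence_of_kanComplex`). -/

/-- The subcomplex of `Δ[N]` which consists of the simplices whose set of vertices belongs to `P`. -/
def facesOf {N : ℕ} (P : LowerSet (Finset (Fin (N + 1)))) : (Δ[N] : SSet.{u}).Subcomplex where
  obj _ := Set.ofPred (fun x ↦ Finset.univ.image (SSet.stdSimplex.asOrderHom x) ∈ P)
  map f x hx := P.lower (by
    intro i hi
    simp only [Finset.mem_image, Finset.mem_univ, true_and] at hi ⊢
    obtain ⟨j, rfl⟩ := hi
    exact ⟨f.unop.toOrderHom j, rfl⟩) hx

lemma mem_facesOf {N : ℕ} (P : LowerSet (Finset (Fin (N + 1)))) {d : SimplexCategoryᵒᵖ}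
    (x : (Δ[N] : SSet.{u}).obj d) :
    x ∈ (facesOf P).obj d ↔ Finset.univ.image (SSet.stdSimplex.asOrderHom x) ∈ P := Iff.rfl

lemma facesOf_mono {N : ℕ} {P Q : LowerSet (Finset (Fin (N + 1)))} (h : P ≤ Q) :
    facesOf.{u} P ≤ facesOf Q := fun _ _ hx ↦ h hx

lemma facesOf_bicartSq {N : ℕ} (P Q : LowerSet (Finset (Fin (N + 1)))) :
    SSet.Subcomplex.BicartSq (facesOf.{u} (P ⊓ Q)) (facesOf P) (facesOf Q) (facesOf (P ⊔ Q)) where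
  sup_eq := rfl
  inf_eq := rfl

/-- The inclusion between subcomplexes given by families of faces. -/
abbrev facesIncl {N : ℕ} {P Q : LowerSet (Finset (Fin (N + 1)))} (h : P ≤ Q) :
    (facesOf.{u} P : SSet.{u}) ⟶ facesOf Q :=
  SSet.Subcomplex.homOfLE (facesOf_mono h)

lemma isIso_fromPreimage {X Y : SSet.{u}} (f : X ⟶ Y) [Mono f] (A : Y.Subcomplex)
    (h : A ≤ SSet.Subcomplex.range f) : IsIso (A.fromPreimage f) := by
  have (d : SimplexCategoryᵒᵖ) : IsIso ((A.fromPreimage f).app d) := by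
    rw [isIso_iff_bijective]
    constructor
    · intro x y hxy
      have := congrArg Subtype.val hxy
      exact Subtype.ext ((mono_iff_injective (f.app d)).1 inferInstance this)
    · rintro ⟨y, hy⟩
      obtain ⟨x, rfl⟩ := h _ hy
      exact ⟨⟨x, hy⟩, rfl⟩
  exact NatIso.isIso_of_isIso_app _

/-- Attaching the simplex `T` to `P` is a pushout along `P ⊓ Iic T ≤ Iic T`. Numbering the vertices
of `T` by `e` turns this inclusion into the horn at `i`, since the facet opposite `e i` is the only
one outside `P`. -/
lemma innerAnodyne_horn_step {N m : ℕ} (P : LowerSet (Finset (Fin (N + 1))))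
    (T : Finset (Fin (N + 1))) (e : Fin (m + 1) ≃o T) (i : Fin (m + 1)) (h0 : 0 < i)
    (hm : i < Fin.last m)
    (hT : T.erase (e i) ∉ P) (h : ∀ j, j ≠ i → T.erase (e j) ∈ P) :
    SSet.innerAnodyneExtensions (facesIncl.{u} (le_sup_left : P ≤ P ⊔ LowerSet.Iic T)) := by
  refine MorphismProperty.of_isPushout (facesOf_bicartSq P (LowerSet.Iic T)).isPushout ?_
  let a : Δ[m] ⟶ (Δ[N] : SSet.{u}) := SSet.stdSimplex.map (SimplexCategory.mkHom
    ⟨fun j ↦ (e j : Fin (N + 1)), fun i j hij ↦ e.monotone hij⟩)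
  have ha (d : SimplexCategoryᵒᵖ) (x : (Δ[m] : SSet.{u}).obj d) (j) :
      SSet.stdSimplex.asOrderHom (a.app _ x) j = e (SSet.stdSimplex.asOrderHom x j) := rfl
  have hmono : Mono a := by
    have (d : SimplexCategoryᵒᵖ) : Mono (a.app d) := by
      rw [mono_iff_injective]
      intro x y hxy
      apply (SSet.stdSimplex.objEquiv).injective
      ext j
      have := congrArg (fun z ↦ SSet.stdSimplex.asOrderHom z j) hxy
      have h2 := e.injective (Subtype.ext this)
      exact congrArg Fin.val h2
    exact NatTrans.mono_of_mono_app _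
  have hr : facesOf (LowerSet.Iic T) ≤ SSet.Subcomplex.range a := by
    intro d x hx
    have hx' (j) : SSet.stdSimplex.asOrderHom x j ∈ T :=
      LowerSet.mem_Iic_iff.1 ((mem_facesOf _ _).1 hx) (Finset.mem_image_of_mem _ (Finset.mem_univ _))
    refine ⟨SSet.stdSimplex.objEquiv.symm (SimplexCategory.mkHom
      ⟨fun j ↦ e.symm ⟨_, hx' j⟩, fun j k hjk ↦ e.symm.monotone
        ((SSet.stdSimplex.asOrderHom x).monotone hjk)⟩), ?_⟩
    apply (SSet.stdSimplex.objEquiv).injective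
    ext j
    change (e (e.symm ⟨_, hx' j⟩)).1.1 = _
    simp
    rfl
  have hi : IsIso ((facesOf (LowerSet.Iic T)).fromPreimage a) := isIso_fromPreimage _ _ hr
  have hi' : IsIso ((facesOf (P ⊓ LowerSet.Iic T)).fromPreimage a) :=
    isIso_fromPreimage _ _ (le_trans (facesOf_mono inf_le_right) hr)
  have htop : (facesOf (LowerSet.Iic T)).preimage a = ⊤ := by
    ext d x
    simp only [SSet.Subcomplex.preimage_obj, Set.mem_preimage, mem_facesOf]
    simp
    intro y hy
    simp at hy
    obtain ⟨j, rfl⟩ := hy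
    exact (e _).2
  have hhorn : (facesOf (P ⊓ LowerSet.Iic T)).preimage a = SSet.horn m i := by
    ext d x
    rw [SSet.mem_horn_iff]
    have himg : Finset.univ.image (SSet.stdSimplex.asOrderHom (a.app _ x)) =
      (Finset.univ.image (SSet.stdSimplex.asOrderHom x)).map
        (e.toEquiv.toEmbedding.trans (Function.Embedding.subtype _)) := by
      ext y
      simp [ha]
    have hle : Finset.univ.image (SSet.stdSimplex.asOrderHom (a.app _ x)) ≤ T := by
      intro y hy
      simp only [Finset.mem_image, Finset.mem_univ, true_and] at hy
      obtain ⟨j, rfl⟩ := hy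
      exact (e _).2
    have key : x ∈ ((facesOf (P ⊓ LowerSet.Iic T)).preimage a).obj d ↔
        Finset.univ.image (SSet.stdSimplex.asOrderHom (a.app _ x)) ∈ P :=
      ⟨fun h ↦ h.1, fun h ↦ ⟨h, hle⟩⟩
    rw [key]
    constructor
    · intro hx hu
      refine hT (P.lower ?_ hx)
      intro y hy
      obtain ⟨j, hj⟩ := e.surjective ⟨y, Finset.mem_of_mem_erase hy⟩
      have hji : j ≠ i := by
        rintro rfl
        rw [hj] at hy
        simp at hy
      have : j ∈ Set.range (SSet.stdSimplex.asOrderHom x) ∪ {i} := by rw [hu]; trivial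
      obtain ⟨k, hk⟩ := this.resolve_right hji
      refine Finset.mem_image.2 ⟨k, Finset.mem_univ _, ?_⟩
      rw [ha, hk, hj]
    · intro hx
      obtain ⟨j, hj⟩ := (Set.ne_univ_iff_exists_notMem _).1 hx
      simp only [Set.mem_union, Set.mem_range, Set.mem_singleton_iff, not_or, not_exists] at hj
      refine P.lower ?_ (h j hj.2)
      intro y hy
      refine Finset.mem_erase.2 ⟨?_, hle hy⟩
      rintro rfl
      simp only [Finset.mem_image, Finset.mem_univ, true_and] at hy
      obtain ⟨k, hk⟩ := hy
      exact hj.1 k (e.injective (Subtype.ext hk))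
  refine (MorphismProperty.arrow_mk_iso_iff _ (Arrow.isoMk
    (SSet.Subcomplex.eqToIso hhorn.symm ≪≫ @asIso _ _ _ _ _ hi')
    ((SSet.Subcomplex.topIso _).symm ≪≫ SSet.Subcomplex.eqToIso htop.symm ≪≫
      @asIso _ _ _ _ _ hi) rfl)).1
    (SSet.innerAnodyneExtensions.horn_ι h0 hm)

/-- If every face in `Q` but not in `P` can be paired, by adding or removing a vertex `v` which is
in its interior, with another such face, then `P ≤ Q` gives an inner anodyne extension. -/
lemma innerAnodyne_of_cone {N : ℕ} (P Q : LowerSet (Finset (Fin (N + 1)))) (hPQ : P ≤ Q)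
    (v : Fin (N + 1)) (h : ∀ S ∈ Q, S ∉ P → insert v S ∈ Q ∧ S.erase v ∉ P ∧
      (∃ a ∈ S, a < v) ∧ (∃ b ∈ S, v < b)) :
    SSet.innerAnodyneExtensions (facesIncl.{u} hPQ) := by
  classical
  induction hc : (Finset.univ.filter (fun S ↦ S ∈ Q ∧ S ∉ P)).card using Nat.strong_induction_on
    generalizing P with | _ c ih
  by_cases hne : ∃ S, S ∈ Q ∧ S ∉ P
  swap
  · obtain rfl : P = Q := le_antisymm hPQ fun S hS ↦ by
      by_contra hSP
      exact hne ⟨S, hS, hSP⟩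
    exact .of_isIso (𝟙 _)
  obtain ⟨S, ⟨hSQ, hSP⟩, hmin⟩ :=
    (measure Finset.card).wf.has_min (Set.ofPred fun S ↦ S ∈ Q ∧ S ∉ P) hne
  have hmin' (S') (h1 : S' ∈ Q) (h2 : S'.card < S.card) : S' ∈ P := by
    by_contra h3
    exact hmin S' ⟨h1, h3⟩ h2
  obtain ⟨hins, hers, ⟨a, haS, hav⟩, ⟨b, hbS, hvb⟩⟩ := h S hSQ hSP
  -- A smallest missing face cannot contain `v`, as its partner without `v` would be smaller. So `S`
  -- is a facet of `T`, and attaching `T` adds just the pair `S`, `T`.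
  have hvS : v ∉ S := fun hv ↦
    hers (hmin' _ (Q.lower (Finset.erase_subset _ _) hSQ) (Finset.card_erase_lt_of_mem hv))
  set T := insert v S with hTdef
  obtain ⟨m, hm⟩ : ∃ m, T.card = m + 1 := ⟨_, Finset.card_insert_of_notMem hvS⟩
  let e := T.orderIsoOfFin hm
  obtain ⟨i, hi⟩ := e.surjective ⟨v, Finset.mem_insert_self _ _⟩
  obtain ⟨ia, hia⟩ := e.surjective ⟨a, Finset.mem_insert_of_mem haS⟩
  obtain ⟨ib, hib⟩ := e.surjective ⟨b, Finset.mem_insert_of_mem hbS⟩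
  have hP' : P ⊔ LowerSet.Iic T ≤ Q := sup_le hPQ (LowerSet.Iic_le.2 hins)
  have step := innerAnodyne_horn_step.{u} P T e i
    (lt_of_le_of_lt (Fin.zero_le ia) (by
      rw [← e.lt_iff_lt, hi, hia]; exact hav))
    (lt_of_lt_of_le (b := ib) (by
      rw [← e.lt_iff_lt, hi, hib]; exact hvb) (Fin.le_last _))
    (by rw [hi]; simpa [T, hvS] using hSP)
    (fun j hj ↦ by
      have hjv : (e j : Fin (N + 1)) ≠ v := fun h' ↦ hj (e.injective (by rw [hi]; exact Subtype.ext h'))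
      have hjS : (e j : Fin (N + 1)) ∈ S := Finset.mem_of_mem_insert_of_ne (e j).2 hjv
      by_contra hnP
      have hQ : T.erase (e j) ∈ Q := Q.lower (Finset.erase_subset _ _) hins
      -- If the facet of `T` opposite `e j` were missing, so would be its partner without `v`, a
      -- proper subset of `S`.
      refine (h _ hQ hnP).2.1 (hmin' _ (Q.lower (Finset.erase_subset _ _) hQ) ?_)
      rw [Finset.erase_right_comm, show T.erase v = S from Finset.erase_insert hvS]
      exact Finset.card_erase_lt_of_mem hjS)
  refine SSet.innerAnodyneExtensions.comp_mem _ (facesIncl.{u} hP') step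
    (ih _ ?_ _ hP' ?_ rfl)
  · rw [← hc]
    refine Finset.card_lt_card ⟨fun U hU ↦ ?_, fun hsub ↦ ?_⟩
    · simp only [Finset.mem_filter, Finset.mem_univ, true_and, LowerSet.mem_sup_iff, not_or] at hU ⊢
      exact ⟨hU.1, hU.2.1⟩
    · have := hsub (Finset.mem_filter.2 ⟨Finset.mem_univ S, hSQ, hSP⟩)
      simp only [Finset.mem_filter, Finset.mem_univ, true_and, LowerSet.mem_sup_iff, not_or] at this
      exact this.2.2 (LowerSet.mem_Iic_iff.2 (Finset.subset_insert _ _))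
  · intro U hUQ hUP
    simp only [LowerSet.mem_sup_iff, not_or, LowerSet.mem_Iic_iff] at hUP
    obtain ⟨h1, h2, h3⟩ := h U hUQ hUP.1
    refine ⟨h1, ?_, h3⟩
    simp only [LowerSet.mem_sup_iff, not_or, LowerSet.mem_Iic_iff]
    refine ⟨h2, fun h4 ↦ hUP.2 fun y hy ↦ ?_⟩
    by_cases hyv : y = v
    · subst hyv; exact Finset.mem_insert_self _ _
    · exact h4 (Finset.mem_erase.2 ⟨hyv, hy⟩)

end InfCosmos

namespace InfCosmos

/-! ### Maps out of subcomplexes of a standard simplex -/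

lemma exists_glue_facesOf {N : ℕ} {P Q : LowerSet (Finset (Fin (N + 1)))} {X : SSet.{u}}
    (f : (facesOf P : SSet.{u}) ⟶ X) (g : (facesOf Q : SSet.{u}) ⟶ X)
    (h : facesIncl (inf_le_left : P ⊓ Q ≤ P) ≫ f = facesIncl (inf_le_right : P ⊓ Q ≤ Q) ≫ g) :
    ∃ φ : (facesOf (P ⊔ Q) : SSet.{u}) ⟶ X,
      facesIncl le_sup_left ≫ φ = f ∧ facesIncl le_sup_right ≫ φ = g :=
  ⟨(facesOf_bicartSq P Q).isPushout.desc f g h,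
    (facesOf_bicartSq P Q).isPushout.inl_desc _ _ _,
    (facesOf_bicartSq P Q).isPushout.inr_desc _ _ _⟩

lemma facesOf_sup_hom_ext {N : ℕ} {P Q : LowerSet (Finset (Fin (N + 1)))} {X : SSet.{u}}
    {f g : (facesOf (P ⊔ Q) : SSet.{u}) ⟶ X}
    (h₁ : facesIncl (le_sup_left : P ≤ P ⊔ Q) ≫ f = facesIncl le_sup_left ≫ g)
    (h₂ : facesIncl (le_sup_right : Q ≤ P ⊔ Q) ≫ f = facesIncl le_sup_right ≫ g) : f = g :=
  (facesOf_bicartSq P Q).isPushout.hom_ext h₁ h₂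

/-- Maps out of a subcomplex of a standard simplex agree if every face is contained in a simplex
on which they agree. -/
lemma facesOf_hom_ext {N : ℕ} {P : LowerSet (Finset (Fin (N + 1)))} {X : SSet.{u}}
    {φ ψ : (facesOf P : SSet.{u}) ⟶ X}
    (h : ∀ S ∈ P, ∃ (m : ℕ) (x : (facesOf P : SSet.{u}) _⦋m⦌),
      S ⊆ Finset.univ.image (SSet.stdSimplex.asOrderHom x.1) ∧ φ.app _ x = ψ.app _ x) :
    φ = ψ := by
  ext d ⟨y, hy⟩
  obtain ⟨m, x, hxy, hx⟩ := h _ hy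
  have key (i) : ∃ j, SSet.stdSimplex.asOrderHom x.1 j = SSet.stdSimplex.asOrderHom y i := by
    simpa using hxy (Finset.mem_image_of_mem _ (Finset.mem_univ i))
  classical
  -- The simplex `y` is `x` restricted along the map sending each position to the first one where
  -- `x` takes the same value.
  let z : d.unop ⟶ ⦋m⦌ := SimplexCategory.mkHom
    ⟨fun i ↦ Fin.find _ (key i), fun i i' hii' ↦ by
      obtain h | h := ((SSet.stdSimplex.asOrderHom y).monotone hii').lt_or_eq
      · refine le_of_lt ?_
        have h1 := Fin.find_spec (key i)
        have h2 := Fin.find_spec (key i')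
        rw [← h1, ← h2] at h
        exact (SSet.stdSimplex.asOrderHom x.1).monotone.reflect_lt h
      · simp [h]⟩
  have hz : (facesOf P : SSet.{u}).map z.op x = ⟨y, hy⟩ := by
    apply Subtype.ext
    apply (SSet.stdSimplex.objEquiv).injective
    ext i
    exact congrArg Fin.val (Fin.find_spec (key i))
  rw [← hz]
  exact (NatTrans.naturality_apply φ z.op x).trans ((congrArg _ hx).trans
    (NatTrans.naturality_apply ψ z.op x).symm)

/-- The map to a standard simplex given by a map between vertices that is monotone on faces. -/
def vertexMap {N n : ℕ} (P : LowerSet (Finset (Fin (N + 1)))) (r : Fin (N + 1) → Fin (n + 1))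
    (hr : ∀ S ∈ P, MonotoneOn r S) : (facesOf P : SSet.{u}) ⟶ Δ[n] where
  app _ := ↾ fun x ↦ SSet.stdSimplex.objEquiv.symm (SimplexCategory.mkHom
    ⟨fun i ↦ r (SSet.stdSimplex.asOrderHom x.1 i), fun i j hij ↦
      hr _ x.2 (Finset.mem_coe.2 (Finset.mem_image_of_mem _ (Finset.mem_univ i)))
        (Finset.mem_coe.2 (Finset.mem_image_of_mem _ (Finset.mem_univ j)))
        ((SSet.stdSimplex.asOrderHom x.1).monotone hij)⟩)
  naturality _ _ _ := rfl

lemma stdSimplex_ext {n : ℕ} {d : SimplexCategoryᵒᵖ} {x y : (Δ[n] : SSet.{u}).obj d}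
    (h : ∀ i, SSet.stdSimplex.asOrderHom x i = SSet.stdSimplex.asOrderHom y i) : x = y := by
  apply (SSet.stdSimplex.objEquiv).injective
  ext i
  exact congrArg Fin.val (h i)

/-- The edge `a ≤ b` as a simplex of a subcomplex of a standard simplex. -/
def edgeIn {N : ℕ} (P : LowerSet (Finset (Fin (N + 1)))) (a b : Fin (N + 1)) (hab : a ≤ b)
    (h : {a, b} ∈ P) : (facesOf P : SSet.{u}) _⦋1⦌ :=
  ⟨SSet.stdSimplex.edge _ a b hab, P.lower (fun i hi ↦ by
    simp only [Finset.mem_image, Finset.mem_univ, true_and] at hi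
    obtain ⟨j, rfl⟩ := hi
    fin_cases j
    · exact Finset.mem_insert_self _ _
    · exact Finset.mem_insert_of_mem (Finset.mem_singleton_self _)) h⟩

lemma subset_image_edgeIn {N : ℕ} (P : LowerSet (Finset (Fin (N + 1)))) (a b : Fin (N + 1))
    (hab : a ≤ b) (h : {a, b} ∈ P) :
    {a, b} ⊆ Finset.univ.image (SSet.stdSimplex.asOrderHom (edgeIn.{u} P a b hab h).1) := by
  intro i hi
  simp only [Finset.mem_insert, Finset.mem_singleton] at hi
  obtain rfl | rfl := hi
  · exact Finset.mem_image.2 ⟨(0 : Fin 2), Finset.mem_univ _, rfl⟩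
  · exact Finset.mem_image.2 ⟨(1 : Fin 2), Finset.mem_univ _, rfl⟩

lemma yonedaEquiv_symm_app_eq {X : SSet.{u}} {n : SimplexCategory} (σ : X.obj (op n))
    {d : SimplexCategory} (y : (SSet.stdSimplex.{u}.obj n).obj (op d)) (f : d ⟶ n)
    (h : y = SSet.stdSimplex.objEquiv.symm f) :
    (SSet.yonedaEquiv.symm σ).app _ y = X.map f.op σ := by
  rw [h]
  exact SSet.yonedaEquiv_symm_app_objEquiv_symm _ _

/-- The property that every edge of a simplicial set has an inverse on one side. -/
def HasEdgeInverses (E : SSet.{u}) : Prop :=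
  ∀ e : E _⦋1⦌, ∃ (v : E _⦋1⦌) (σ : E _⦋2⦌),
    E.δ 2 σ = v ∧ E.δ 0 σ = e ∧ E.δ 1 σ = E.σ 0 (E.δ 0 e)

/-- Faces whose vertices lie in the interval from `a` to `b`. -/
def facesBetween (N a b : ℕ) : LowerSet (Finset (Fin (N + 1))) where
  carrier := Set.ofPred fun S ↦ ∀ i ∈ S, a ≤ i.1 ∧ i.1 ≤ b
  lower' _ _ hST hS i hi := hS i (hST hi)

lemma mem_facesBetween {N a b : ℕ} {S : Finset (Fin (N + 1))} :
    S ∈ facesBetween N a b ↔ ∀ i ∈ S, a ≤ i.1 ∧ i.1 ≤ b := Iff.rfl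

lemma pair_mem_facesBetween {N a b : ℕ} {i j : Fin (N + 1)} (hi : a ≤ i.1 ∧ i.1 ≤ b)
    (hj : a ≤ j.1 ∧ j.1 ≤ b) : {i, j} ∈ facesBetween N a b := by
  rw [mem_facesBetween]
  simp [hi, hj]

/-- The first vertices of `Δ[k + 4]`. -/
def vtx (k i : ℕ) (h : i < 5 := by decide) : Fin (k + 4 + 1) := ⟨i, by omega⟩

@[simp]
lemma val_vtx (k i : ℕ) (h : i < 5) : (vtx k i h).1 = i := rfl

lemma vtx_le (k : ℕ) {i j : ℕ} (hi : i < 5) (hj : j < 5) (h : i ≤ j) :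
    vtx k i hi ≤ vtx k j hj := h

lemma app_edgeIn_of_le {N : ℕ} {P Q : LowerSet (Finset (Fin (N + 1)))} (hPQ : P ≤ Q)
    {X : SSet.{u}} {φ : (facesOf P : SSet.{u}) ⟶ X} {ψ : (facesOf Q : SSet.{u}) ⟶ X}
    (h : facesIncl hPQ ≫ ψ = φ) (a b : Fin (N + 1)) (hab : a ≤ b) (hP : {a, b} ∈ P) :
    ψ.app _ (edgeIn Q a b hab (hPQ hP)) = φ.app _ (edgeIn P a b hab hP) := by
  subst h
  rfl

/-- The hypothesis is used twice, for `e` and for its inverse `v`. The two resulting triangles share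
the edge `v`, placed on `1 → 2`. Their long edges `1 → 3` and `0 → 2` are degenerate at the target
and the source of `e`, which is what collapsing these edges requires. -/
lemma exists_inverse_triangles {E : SSet.{u}} (hE : HasEdgeInverses E) (k : ℕ) (e : E _⦋1⦌) :
    ∃ w : (facesOf (facesBetween (k + 4) 0 2 ⊔ facesBetween (k + 4) 1 3) : SSet.{u}) ⟶ E,
      w.app _ (edgeIn _ (vtx k 2) (vtx k 3) (vtx_le k _ _ (by decide))
        (Or.inr (pair_mem_facesBetween (by simp) (by simp)))) = e ∧
      w.app _ (edgeIn _ (vtx k 1) (vtx k 3) (vtx_le k _ _ (by decide))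
        (Or.inr (pair_mem_facesBetween (by simp) (by simp)))) = E.σ 0 (E.δ 0 e) ∧
      w.app _ (edgeIn _ (vtx k 0) (vtx k 2) (vtx_le k _ _ (by decide))
        (Or.inl (pair_mem_facesBetween (by simp) (by simp)))) = E.σ 0 (E.δ 1 e) := by
  obtain ⟨v, σ, hv, hσe, hσ⟩ := hE e
  obtain ⟨v', τ, hv', hτv, hτ⟩ := hE v
  -- Only the values of `r₁` on `1, 2, 3` and of `r₂` on `0, 1, 2` matter; the others keep the maps
  -- monotone.
  let r₁ : Fin (k + 4 + 1) → Fin 3 := fun i ↦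
    ⟨if i.1 ≤ 1 then 0 else if i.1 = 2 then 1 else 2, by split_ifs <;> omega⟩
  let r₂ : Fin (k + 4 + 1) → Fin 3 := fun i ↦
    ⟨if i.1 = 0 then 0 else if i.1 = 1 then 1 else 2, by split_ifs <;> omega⟩
  have hr₁ : Monotone r₁ := by
    intro i j hij
    simp only [r₁, Fin.le_def] at hij ⊢
    split_ifs <;> omega
  have hr₂ : Monotone r₂ := by
    intro i j hij
    simp only [r₂, Fin.le_def] at hij ⊢
    split_ifs <;> omega
  let w₁ := vertexMap (facesBetween (k + 4) 1 3) r₁ (fun S _ ↦ hr₁.monotoneOn _) ≫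
    SSet.yonedaEquiv.symm σ
  let w₂ := vertexMap (facesBetween (k + 4) 0 2) r₂ (fun S _ ↦ hr₂.monotoneOn _) ≫
    SSet.yonedaEquiv.symm τ
  have hw₁ (a b : Fin (k + 4 + 1)) (hab h) (j : Fin 3) (ha : r₁ a = (Fin.succAbove j 0))
      (hb : r₁ b = Fin.succAbove j 1) : w₁.app _ (edgeIn _ a b hab h) = E.δ j σ := by
    refine yonedaEquiv_symm_app_eq _ _ (SimplexCategory.δ j) (stdSimplex_ext fun i ↦ ?_)
    fin_cases i
    · exact ha
    · exact hb
  have hw₂ (a b : Fin (k + 4 + 1)) (hab h) (j : Fin 3) (ha : r₂ a = (Fin.succAbove j 0))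
      (hb : r₂ b = Fin.succAbove j 1) : w₂.app _ (edgeIn _ a b hab h) = E.δ j τ := by
    refine yonedaEquiv_symm_app_eq _ _ (SimplexCategory.δ j) (stdSimplex_ext fun i ↦ ?_)
    fin_cases i
    · exact ha
    · exact hb
  have hvt : E.δ 0 v = E.δ 1 e := by
    rw [← hv, ← hσe]
    exact (ConcreteCategory.congr_hom (E.δ_comp_δ (i := 0) (j := 1) (by simp)) σ)
  have t₄ := hw₁ (vtx k 1) (vtx k 2) (vtx_le k _ _ (by decide))
    (pair_mem_facesBetween (by simp) (by simp)) 2 rfl rfl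
  have t₅ := hw₂ (vtx k 1) (vtx k 2) (vtx_le k _ _ (by decide))
    (pair_mem_facesBetween (by simp) (by simp)) 0 rfl rfl
  obtain ⟨w, h2, h1⟩ := exists_glue_facesOf w₂ w₁ (by
    refine facesOf_hom_ext fun S hS ↦ ⟨1, edgeIn _ (vtx k 1) (vtx k 2) (vtx_le k _ _ (by decide))
      ⟨pair_mem_facesBetween (by simp) (by simp), pair_mem_facesBetween (by simp) (by simp)⟩,
      Finset.Subset.trans ?_ (subset_image_edgeIn _ _ _ _ _), ?_⟩
    · intro i hi
      have a1 := hS.1 i hi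
      have a2 := hS.2 i hi
      simp only [Finset.mem_insert, Finset.mem_singleton, Fin.ext_iff, val_vtx]
      omega
    · exact t₅.trans ((hτv.trans hv.symm).trans t₄.symm))
  have t₁ := hw₁ (vtx k 2) (vtx k 3) (vtx_le k _ _ (by decide))
    (pair_mem_facesBetween (by simp) (by simp)) 0 rfl rfl
  have t₂ := hw₁ (vtx k 1) (vtx k 3) (vtx_le k _ _ (by decide))
    (pair_mem_facesBetween (by simp) (by simp)) 1 rfl rfl
  have t₃ := hw₂ (vtx k 0) (vtx k 2) (vtx_le k _ _ (by decide))
    (pair_mem_facesBetween (by simp) (by simp)) 1 rfl rfl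
  refine ⟨w, ?_, ?_, ?_⟩
  · exact (app_edgeIn_of_le le_sup_right h1 _ _ _ _).trans (t₁.trans hσe)
  · exact (app_edgeIn_of_le le_sup_right h1 _ _ _ _).trans (t₂.trans hσ)
  · rw [← hvt]
    exact (app_edgeIn_of_le le_sup_left h2 _ _ _ _).trans (t₃.trans hτ)

end InfCosmos

namespace InfCosmos

/-! ### Lifting against special outer horns -/

lemma exists_lift_of_innerAnodyne {X Y E B : SSet.{u}} {i : X ⟶ Y}
    (hi : SSet.innerAnodyneExtensions i) {p : E ⟶ B} (hp : SSet.innerFibrations p)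
    (f : X ⟶ E) (g : Y ⟶ B) (h : f ≫ p = i ≫ g) : ∃ l : Y ⟶ E, i ≫ l = f ∧ l ≫ p = g := by
  have := hi p hp
  have sq : CommSq f i p g := ⟨h⟩
  exact ⟨sq.lift, sq.fac_left, sq.fac_right⟩

lemma exists_extension_of_innerAnodyne {X Y B : SSet.{u}} {i : X ⟶ Y}
    (hi : SSet.innerAnodyneExtensions i) [SSet.Quasicategory B] (f : X ⟶ B) :
    ∃ l : Y ⟶ B, i ≫ l = f := by
  obtain ⟨l, hl, -⟩ := exists_lift_of_innerAnodyne hi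
    (SSet.mem_innerFibrations (terminal.from B)) f (terminal.from _)
    (terminal.hom_ext _ _)
  exact ⟨l, hl⟩

/-- The property of a set of vertices of `Δ[k + 4]` to contain all but the first four. -/
def ContainsTail (k : ℕ) (S : Finset (Fin (k + 4 + 1))) : Prop := ∀ i, 4 ≤ i.1 → i ∈ S

lemma ContainsTail.mono {k : ℕ} {S T : Finset (Fin (k + 4 + 1))} (h : S ⊆ T)
    (hS : ContainsTail k S) : ContainsTail k T := fun i hi ↦ h (hS i hi)

lemma containsTail_insert {k : ℕ} {S : Finset (Fin (k + 4 + 1))} {i : ℕ} {h : i < 5}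
    (hi : i < 4) :
    ContainsTail k (insert (vtx k i h) S) ↔ ContainsTail k S :=
  ⟨fun h j hj ↦ Finset.mem_of_mem_insert_of_ne (h j hj) (by
    rintro rfl
    simp at hj
    omega), .mono (Finset.subset_insert _ _)⟩

lemma containsTail_erase {k : ℕ} {S : Finset (Fin (k + 4 + 1))} {i : ℕ} {h : i < 5}
    (hi : i < 4) :
    ContainsTail k (S.erase (vtx k i h)) ↔ ContainsTail k S :=
  ⟨.mono (Finset.erase_subset _ _), fun h j hj ↦ Finset.mem_erase.2 ⟨by
    rintro rfl
    simp at hj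
    omega, h j hj⟩⟩

/-- Faces omitting the vertex `i`. -/
def facesOmitting {N : ℕ} (i : Fin (N + 1)) : LowerSet (Finset (Fin (N + 1))) where
  carrier := Set.ofPred fun S ↦ i ∉ S
  lower' _ _ hST hS h := hS (hST h)

lemma mem_facesOmitting {N : ℕ} {i : Fin (N + 1)} {S : Finset (Fin (N + 1))} :
    S ∈ facesOmitting i ↔ i ∉ S := Iff.rfl

/-- Faces omitting a vertex `i ≥ 4`. -/
def facesNotTail (k : ℕ) : LowerSet (Finset (Fin (k + 4 + 1))) where
  carrier := Set.ofPred fun S ↦ ¬ ContainsTail k S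
  lower' _ _ hST hS h := hS (h.mono hST)

/-- The collapse of `Δ[k + 4]` onto `Δ[k + 2]` which identifies `0` with `2` and `1` with `3`. -/
def collapse (k : ℕ) (i : Fin (k + 4 + 1)) : Fin (k + 2 + 1) :=
  ⟨if i.1 = 0 ∨ i.1 = 2 then 0 else if i.1 ≤ 3 then 1 else i.1 - 2, by split_ifs <;> omega⟩

/-- The faces on which the collapse is monotone. -/
def collapsible (k : ℕ) : LowerSet (Finset (Fin (k + 4 + 1))) :=
  facesOmitting (vtx k 1) ⊔ (facesOmitting (vtx k 0) ⊓ facesOmitting (vtx k 2))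

lemma monotoneOn_collapse {k : ℕ} {S : Finset (Fin (k + 4 + 1))} (hS : S ∈ collapsible k) :
    MonotoneOn (collapse k) S := by
  intro i hi j hj hij
  have key : ¬ (i.1 = 1 ∧ j.1 = 2) := by
    rintro ⟨h1, h2⟩
    obtain rfl : i = vtx k 1 := Fin.ext h1
    obtain rfl : j = vtx k 2 := Fin.ext h2
    obtain h | h := hS
    · exact h hi
    · exact h.2 hj
  simp only [collapse, Fin.le_def] at hij ⊢
  split_ifs <;> omega

/-- The faces which the collapse maps into the horn at `0`. -/
def collapsesToHorn (k : ℕ) : LowerSet (Finset (Fin (k + 4 + 1))) :=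
  facesNotTail k ⊔ (facesOmitting (vtx k 1) ⊓ facesOmitting (vtx k 3))

lemma collapse_mem_horn {k : ℕ} {S : Finset (Fin (k + 4 + 1))} (hS : S ∈ collapsesToHorn k) :
    ∃ j : Fin (k + 2 + 1), j ≠ 0 ∧ ∀ i ∈ S, collapse k i ≠ j := by
  obtain h | h := hS
  · have h : ¬ ∀ i, 4 ≤ i.1 → i ∈ S := h
    push Not at h
    obtain ⟨j, hj, hjS⟩ := h
    refine ⟨⟨j.1 - 2, by omega⟩, by simp [Fin.ext_iff]; omega, fun i hi h ↦ hjS ?_⟩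
    obtain rfl : i = j := by
      simp only [collapse, Fin.ext_iff] at h ⊢
      split_ifs at h <;> omega
    exact hi
  · refine ⟨⟨1, by omega⟩, by simp, fun i hi hij ↦ ?_⟩
    simp only [collapse, Fin.ext_iff] at hij
    split_ifs at hij with h1 h2
    · obtain h' | h' : i.1 = 1 ∨ i.1 = 3 := by omega
      · exact h.1 ((Fin.ext h' : i = vtx k 1) ▸ hi)
      · exact h.2 ((Fin.ext h' : i = vtx k 3) ▸ hi)
    · omega

/-! ### Inner anodyne inclusions between families of faces of `Δ[k + 4]` -/

section cones

variable (k : ℕ)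

/-- The faces contained in the first or in the last face of `Δ[{0, 1, 2, 3}]`. -/
abbrev facesTriangles : LowerSet (Finset (Fin (k + 4 + 1))) :=
  facesBetween (k + 4) 0 2 ⊔ facesBetween (k + 4) 1 3

lemma vtx_ne {i j : ℕ} {hi : i < 5} {hj : j < 5} (h : i ≠ j) : vtx k i hi ≠ vtx k j hj := by
  simpa [Fin.ext_iff] using h

lemma exists_four_le {S : Finset (Fin (k + 4 + 1))} (h : S ∉ facesTriangles k)
    (h0 : vtx k 0 ∉ S) : ∃ i ∈ S, 4 ≤ i.1 := by
  by_contra! h'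
  refine h (Or.inr fun i hi ↦ ⟨?_, by have := h' i hi; omega⟩)
  by_contra! h1
  exact h0 ((Fin.ext (Nat.lt_one_iff.1 h1) : i = vtx k 0) ▸ hi)

lemma exists_three_le {S : Finset (Fin (k + 4 + 1))} (h : S ∉ facesTriangles k) :
    ∃ i ∈ S, 3 ≤ i.1 := by
  by_contra! h'
  exact h (Or.inl fun i hi ↦ ⟨by omega, by have := h' i hi; omega⟩)

lemma notMem_facesTriangles_of_four_le {S : Finset (Fin (k + 4 + 1))} {i : Fin (k + 4 + 1)}
    (hi : i ∈ S) (h4 : 4 ≤ i.1) : S ∉ facesTriangles k := by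
  rintro (h | h)
  · have := h i hi; omega
  · have := h i hi; omega

lemma notMem_facesTriangles_of_three_le {S : Finset (Fin (k + 4 + 1))} {i : Fin (k + 4 + 1)}
    (hi : i ∈ S) (h3 : 3 ≤ i.1) (h0 : vtx k 0 ∈ S) : S ∉ facesTriangles k := by
  rintro (h | h)
  · have := h i hi; omega
  · have := h _ h0; simp at this

/-- A missing face contains `1`, `2` and some vertex from `4` on, so adding or removing `3` happens
in its interior. -/
lemma innerAnodyne_base₁ : SSet.innerAnodyneExtensions (facesIncl.{u}
    (le_sup_left : collapsible k ⊔ facesTriangles k ≤ collapsible k ⊔ facesTriangles k ⊔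
      facesOmitting (vtx k 0))) := by
  refine innerAnodyne_of_cone _ _ _ (vtx k 3) fun S hSQ hSP ↦ ?_
  have h0 : vtx k 0 ∉ S := hSQ.resolve_left hSP
  have h1 : vtx k 1 ∈ S := by
    by_contra h; exact hSP (Or.inl (Or.inl h))
  have h2 : vtx k 2 ∈ S := by
    by_contra h; exact hSP (Or.inl (Or.inr ⟨h0, h⟩))
  obtain ⟨i, hi, hi4⟩ := exists_four_le k (fun h ↦ hSP (Or.inr h)) h0
  refine ⟨Or.inr ?_, ?_, ⟨_, h2, by simp [Fin.lt_def]⟩, ⟨i, hi, by simp [Fin.lt_def]; omega⟩⟩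
  · simp [mem_facesOmitting, h0, Fin.ext_iff]
  · rintro ((h | h) | h)
    · exact h (Finset.mem_erase.2 ⟨vtx_ne k (by decide), h1⟩)
    · exact h.2 (Finset.mem_erase.2 ⟨vtx_ne k (by decide), h2⟩)
    · exact notMem_facesTriangles_of_four_le k (Finset.mem_erase.2 ⟨by
        rintro rfl
        simp at hi4, hi⟩) hi4 h

/-- A missing face contains `0`, `1` and some vertex from `3` on, so `2` can serve as the interior
vertex. -/
lemma innerAnodyne_base₂ : SSet.innerAnodyneExtensions (facesIncl.{u}
    (le_top : collapsible k ⊔ facesTriangles k ⊔ facesOmitting (vtx k 0) ≤ ⊤)) := by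
  refine innerAnodyne_of_cone _ _ _ (vtx k 2) fun S hSQ hSP ↦ ?_
  have h0 : vtx k 0 ∈ S := by
    by_contra h; exact hSP (Or.inr h)
  have h1 : vtx k 1 ∈ S := by
    by_contra h; exact hSP (Or.inl (Or.inl (Or.inl h)))
  obtain ⟨i, hi, hi3⟩ := exists_three_le k (fun h ↦ hSP (Or.inl (Or.inr h)))
  have h0' : vtx k 0 ∈ S.erase (vtx k 2) := Finset.mem_erase.2 ⟨vtx_ne k (by decide), h0⟩
  refine ⟨trivial, ?_, ⟨_, h1, by simp [Fin.lt_def]⟩, ⟨i, hi, by simp [Fin.lt_def]; omega⟩⟩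
  rintro (((h | h) | h) | h)
  · exact h (Finset.mem_erase.2 ⟨vtx_ne k (by decide), h1⟩)
  · exact h.1 h0'
  · exact notMem_facesTriangles_of_three_le k (Finset.mem_erase.2 ⟨by
      rintro rfl
      simp at hi3, hi⟩) hi3 h0' h
  · exact h h0'

lemma mem_collapsesToHorn_of_facesTriangles {S : Finset (Fin (k + 4 + 1))}
    (h : S ∈ facesTriangles k) : S ∈ collapsesToHorn k :=
  Or.inl fun hS ↦ notMem_facesTriangles_of_four_le k (hS ⟨4, by omega⟩ le_rfl) le_rfl h

/-- The pairing of `innerAnodyne_base₁` restricts to the faces that collapse into the horn: the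
missing ones contain `1`, hence omit a tail vertex, and adding `3` does not change this. -/
lemma innerAnodyne_lift₁ (h : (collapsible k ⊓ collapsesToHorn k) ⊔ facesTriangles k ≤
      (collapsible k ⊔ facesTriangles k ⊔ facesOmitting (vtx k 0)) ⊓ collapsesToHorn k) :
    SSet.innerAnodyneExtensions (facesIncl.{u} h) := by
  refine innerAnodyne_of_cone _ _ _ (vtx k 3) fun S hSQ hSP ↦ ?_
  have hR : S ∉ collapsible k := fun h ↦ hSP (Or.inl ⟨h, hSQ.2⟩)
  have h0 : vtx k 0 ∉ S := (hSQ.1.resolve_left (by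
    rintro (h | h)
    · exact hR h
    · exact hSP (Or.inr h)))
  have h1 : vtx k 1 ∈ S := by
    by_contra h; exact hR (Or.inl h)
  have h2 : vtx k 2 ∈ S := by
    by_contra h; exact hR (Or.inr ⟨h0, h⟩)
  have hT : ¬ ContainsTail k S := hSQ.2.resolve_right fun h ↦ h.1 h1
  obtain ⟨i, hi, hi4⟩ := exists_four_le k (fun h ↦ hSP (Or.inr h)) h0
  refine ⟨⟨Or.inr ?_, Or.inl ?_⟩, ?_, ⟨_, h2, by simp [Fin.lt_def]⟩,
    ⟨i, hi, by simp [Fin.lt_def]; omega⟩⟩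
  · simp [mem_facesOmitting, h0, Fin.ext_iff]
  · exact fun h ↦ hT ((containsTail_insert (by decide)).1 h)
  · rintro (⟨h | h, -⟩ | h)
    · exact h (Finset.mem_erase.2 ⟨vtx_ne k (by decide), h1⟩)
    · exact h.2 (Finset.mem_erase.2 ⟨vtx_ne k (by decide), h2⟩)
    · exact notMem_facesTriangles_of_four_le k (Finset.mem_erase.2 ⟨by
        rintro rfl
        simp at hi4, hi⟩) hi4 h

/-- The missing faces are paired by `2`. Either they contain `1` and the whole tail and omit `3`, or
they are missing as in `innerAnodyne_base₂`. The target contains the face formed by `1` and the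
tail, a copy of the facet absent from the horn. -/
lemma innerAnodyne_lift₂
    (h : (collapsible k ⊔ facesTriangles k ⊔ facesOmitting (vtx k 0)) ⊓ collapsesToHorn k ≤
      facesNotTail k ⊔ facesOmitting (vtx k 3)) :
    SSet.innerAnodyneExtensions (facesIncl.{u} h) := by
  refine innerAnodyne_of_cone _ _ _ (vtx k 2) fun S hSQ hSP ↦ ?_
  have hins : insert (vtx k 2) S ∈ facesNotTail k ⊔ facesOmitting (vtx k 3) := by
    obtain h | h := hSQ
    · exact Or.inl fun h' ↦ h ((containsTail_insert (by decide)).1 h')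
    · exact Or.inr fun h' ↦ h (Finset.mem_of_mem_insert_of_ne h' (vtx_ne k (by decide)))
  by_cases hQ : S ∈ collapsible k ⊔ facesTriangles k ⊔ facesOmitting (vtx k 0)
  · have hG : S ∉ collapsesToHorn k := fun h ↦ hSP ⟨hQ, h⟩
    have hT : ContainsTail k S := by
      by_contra h; exact hG (Or.inl h)
    have h3 : vtx k 3 ∉ S := hSQ.resolve_left fun h ↦ h hT
    have h1 : vtx k 1 ∈ S := by
      by_contra h; exact hG (Or.inr ⟨h, h3⟩)
    refine ⟨hins, ?_, ⟨_, h1, by simp [Fin.lt_def]⟩, ⟨⟨4, by omega⟩, hT _ le_rfl,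
      by simp [Fin.lt_def]⟩⟩
    rintro ⟨-, h | h⟩
    · exact h ((containsTail_erase (by decide)).2 hT)
    · exact h.1 (Finset.mem_erase.2 ⟨vtx_ne k (by decide), h1⟩)
  · have h0 : vtx k 0 ∈ S := by
      by_contra h; exact hQ (Or.inr h)
    have h1 : vtx k 1 ∈ S := by
      by_contra h; exact hQ (Or.inl (Or.inl (Or.inl h)))
    obtain ⟨i, hi, hi3⟩ := exists_three_le k (fun h ↦ hQ (Or.inl (Or.inr h)))
    have h0' : vtx k 0 ∈ S.erase (vtx k 2) := Finset.mem_erase.2 ⟨vtx_ne k (by decide), h0⟩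
    refine ⟨hins, ?_, ⟨_, h1, by simp [Fin.lt_def]⟩, ⟨i, hi, by simp [Fin.lt_def]; omega⟩⟩
    rintro ⟨((h | h) | h) | h, -⟩
    · exact h (Finset.mem_erase.2 ⟨vtx_ne k (by decide), h1⟩)
    · exact h.1 h0'
    · exact notMem_facesTriangles_of_three_le k (Finset.mem_erase.2 ⟨by
        rintro rfl
        simp at hi3, hi⟩) hi3 h0' h
    · exact h h0'

/-- Just two faces are missing: `0, 3` with the tail, and the same face with `1` added. This is one
inner horn at `1`. -/
lemma innerAnodyne_lift₃
    (h : facesNotTail k ⊔ facesOmitting (vtx k 3) ⊔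
      (facesOmitting (vtx k 0) ⊓ facesOmitting (vtx k 2)) ≤
      facesNotTail k ⊔ facesOmitting (vtx k 3) ⊔ facesOmitting (vtx k 2)) :
    SSet.innerAnodyneExtensions (facesIncl.{u} h) := by
  refine innerAnodyne_of_cone _ _ _ (vtx k 1) fun S hSQ hSP ↦ ?_
  have h2 : vtx k 2 ∉ S := hSQ.resolve_left fun h ↦ hSP (Or.inl h)
  have h3 : vtx k 3 ∈ S := by
    by_contra h; exact hSP (Or.inl (Or.inr h))
  have h0 : vtx k 0 ∈ S := by
    by_contra h; exact hSP (Or.inr ⟨h, h2⟩)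
  have hT : ContainsTail k S := by
    by_contra h; exact hSP (Or.inl (Or.inl h))
  refine ⟨Or.inr ?_, ?_, ⟨_, h0, by simp [Fin.lt_def]⟩, ⟨_, h3, by simp [Fin.lt_def]⟩⟩
  · exact fun h' ↦ h2 (Finset.mem_of_mem_insert_of_ne h' (vtx_ne k (by decide)))
  · rintro ((h | h) | h)
    · exact h ((containsTail_erase (by decide)).2 hT)
    · exact h (Finset.mem_erase.2 ⟨vtx_ne k (by decide), h3⟩)
    · exact h.1 (Finset.mem_erase.2 ⟨vtx_ne k (by decide), h0⟩)

end cones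

/-- The faces on which the collapse does not see the triangles. -/
lemma subset_edge_of_mem {k : ℕ} {S : Finset (Fin (k + 4 + 1))} (hR : S ∈ collapsible k)
    (hW : S ∈ facesTriangles k) :
    S ⊆ {vtx k 0, vtx k 2} ∨ S ⊆ {vtx k 1, vtx k 3} ∨ S ⊆ {vtx k 2, vtx k 3} := by
  have key (i j : ℕ) (hi hj) (h : ∀ l ∈ S, l.1 = i ∨ l.1 = j) : S ⊆ {vtx k i hi, vtx k j hj} := by
    intro l hl
    simpa [Fin.ext_iff] using h l hl
  have ne (i : ℕ) (hi) (hS : vtx k i hi ∉ S) (l) (hl : l ∈ S) : l.1 ≠ i := by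
    intro h
    exact hS ((Fin.ext h : l = vtx k i hi) ▸ hl)
  obtain h1 | ⟨h0, h2⟩ := hR
  · obtain h | h := hW
    · refine Or.inl (key _ _ _ _ fun l hl ↦ ?_)
      have := h l hl
      have := ne _ _ h1 l hl
      omega
    · refine Or.inr (Or.inr (key _ _ _ _ fun l hl ↦ ?_))
      have := h l hl
      have := ne _ _ h1 l hl
      omega
  · refine Or.inr (Or.inl (key _ _ _ _ fun l hl ↦ ?_))
    have a0 := ne _ _ h0 l hl
    have a2 := ne _ _ h2 l hl
    obtain h | h := hW
    · have := h l hl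
      omega
    · have := h l hl
      omega

/-- The map identifying the vertex `3` with `1`. -/
def identify (k : ℕ) (i : Fin (k + 4 + 1)) : Fin (k + 4 + 1) :=
  if i = vtx k 3 then vtx k 1 else i

lemma identify_of_ne {k : ℕ} {i : Fin (k + 4 + 1)} (h : i ≠ vtx k 3) : identify k i = i := by
  simp [identify, h]

lemma identify_ne (k : ℕ) (i : Fin (k + 4 + 1)) : identify k i ≠ vtx k 3 := by
  rw [identify]
  split_ifs with h
  · exact vtx_ne k (by decide)
  · exact h

lemma identify_ne_of_ne {k : ℕ} {i : Fin (k + 4 + 1)} {j : ℕ} {hj : j < 5} (h : i ≠ vtx k j hj)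
    (hj1 : j ≠ 1) : identify k i ≠ vtx k j hj := by
  rw [identify]
  split_ifs
  · exact vtx_ne k hj1.symm
  · exact h

lemma eq_of_four_le_identify {k : ℕ} {i j : Fin (k + 4 + 1)} (h : identify k i = j)
    (hj : 4 ≤ j.1) : i = j := by
  subst h
  rw [identify] at hj ⊢
  split_ifs at hj ⊢
  · simp at hj
  · rfl

lemma collapse_identify (k : ℕ) (i : Fin (k + 4 + 1)) :
    collapse k (identify k i) = collapse k i := by
  rw [identify]
  split_ifs with h
  · subst h
    rfl
  · rfl

lemma monotoneOn_identify {k : ℕ} {S : Finset (Fin (k + 4 + 1))}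
    (hS : S ∈ facesOmitting (vtx k 0) ⊓ facesOmitting (vtx k 2)) :
    MonotoneOn (identify k) S := by
  intro i hi j hj hij
  have hi0 : i.1 ≠ 0 := fun h ↦ hS.1 ((Fin.ext h : i = vtx k 0) ▸ hi)
  have hj0 : j.1 ≠ 0 := fun h ↦ hS.1 ((Fin.ext h : j = vtx k 0) ▸ hj)
  have hi2 : i.1 ≠ 2 := fun h ↦ hS.2 ((Fin.ext h : i = vtx k 2) ▸ hi)
  have hj2 : j.1 ≠ 2 := fun h ↦ hS.2 ((Fin.ext h : j = vtx k 2) ▸ hj)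
  simp only [identify, Fin.ext_iff, Fin.le_def, val_vtx] at hij ⊢
  split_ifs <;> (try simp only [val_vtx]) <;> omega

/-- The section of the collapse with image the face which omits the vertices `1` and `2`. -/
def expand (k : ℕ) (i : Fin (k + 2 + 1)) : Fin (k + 4 + 1) :=
  ⟨if i.1 = 0 then 0 else i.1 + 2, by split_ifs <;> omega⟩

lemma monotone_expand (k : ℕ) : Monotone (expand k) := by
  intro i j hij
  simp only [expand, Fin.le_def] at hij ⊢
  split_ifs <;> omega

lemma collapse_expand (k : ℕ) (i : Fin (k + 2 + 1)) : collapse k (expand k i) = i := by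
  by_cases h : i.1 = 0
  · simp [collapse, expand, Fin.ext_iff, h]
  · have he : (expand k i).1 = i.1 + 2 := by simp [expand, h]
    simp only [collapse, Fin.ext_iff, he]
    rw [if_neg (by omega)]
    split_ifs <;> omega

lemma expand_ne_vtx (k : ℕ) (i : Fin (k + 2 + 1)) {j : ℕ} {hj : j < 5} (h : j = 1 ∨ j = 2) :
    expand k i ≠ vtx k j hj := by
  simp only [expand, ne_eq, Fin.ext_iff, val_vtx]
  split_ifs <;> omega

/-- An inner fibration between quasi-categories lifts against the outer horn at `0` if the edges
of its source have inverses. -/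
lemma exists_lift_horn_zero {E B : SSet.{u}} [SSet.Quasicategory B] (hE : HasEdgeInverses E)
    {p : E ⟶ B} (hp : SSet.innerFibrations p) (k : ℕ) (f : (SSet.horn (k + 2) 0 : SSet.{u}) ⟶ E)
    (β : Δ[k + 2] ⟶ B) (hf : f ≫ p = (SSet.horn (k + 2) 0).ι ≫ β) :
    ∃ g : Δ[k + 2] ⟶ E, (SSet.horn (k + 2) 0).ι ≫ g = f ∧ g ≫ p = β := by
  -- the data on the collapsible faces
  let r : (facesOf (collapsible k) : SSet.{u}) ⟶ Δ[k + 2] :=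
    vertexMap _ (collapse k) fun S hS ↦ monotoneOn_collapse hS
  let s : (facesOf (collapsible k ⊓ collapsesToHorn k) : SSet.{u}) ⟶ SSet.horn (k + 2) 0 :=
    SSet.Subcomplex.lift (facesIncl inf_le_left ≫ r) (by
      rintro d _ ⟨⟨x, hx⟩, rfl⟩
      rw [SSet.mem_horn_iff]
      intro hu
      obtain ⟨j, hj0, hj⟩ := collapse_mem_horn hx.2
      have hj' : j ∈ Set.univ := trivial
      rw [← hu] at hj'
      obtain ⟨i, hi⟩ | h := hj'
      · exact hj _ (Finset.mem_image_of_mem _ (Finset.mem_univ i)) hi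
      · exact hj0 h)
  have hs : s ≫ (SSet.horn (k + 2) 0).ι = facesIncl inf_le_left ≫ r := rfl
  -- the first edge of the horn
  let e₀ : (SSet.horn.{u} (k + 2) 0 : SSet.{u}) _⦋1⦌ :=
    ⟨SSet.stdSimplex.edge _ 0 1 (Fin.zero_le _), by
      rw [SSet.mem_horn_iff]
      intro hu
      have h2 : (⟨2, by omega⟩ : Fin (k + 2 + 1)) ∈ Set.univ := trivial
      rw [← hu] at h2
      obtain ⟨i, hi⟩ | h := h2
      · fin_cases i
        · exact absurd (congrArg Fin.val hi) (by change ¬ ((0 : Fin (k + 2 + 1)).1 = 2); simp)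
        · exact absurd (congrArg Fin.val hi) (by change ¬ ((1 : Fin (k + 2 + 1)).1 = 2); simp)
      · exact absurd (congrArg Fin.val h) (by simp)⟩
  have hmem {i j : ℕ} (hi : i < 5) (hj : j < 5) (h₁ : {vtx k i hi, vtx k j hj} ∈ collapsible k)
      (h₂ : {vtx k i hi, vtx k j hj} ∈ facesTriangles k) : {vtx k i hi, vtx k j hj} ∈
      (collapsible k ⊓ collapsesToHorn k) ⊓ facesTriangles k :=
    ⟨⟨h₁, mem_collapsesToHorn_of_facesTriangles k h₂⟩, h₂⟩
  obtain ⟨w, hw₁, hw₂, hw₃⟩ := exists_inverse_triangles hE k (f.app _ e₀)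
  -- The overlap consists of the edges `0 → 2`, `1 → 3`, `2 → 3` and their vertices. The collapse
  -- makes the first two degenerate and sends the third to the first edge of the horn, in agreement
  -- with the edges of `w`.
  have hsw : facesIncl inf_le_left ≫ s ≫ f = facesIncl inf_le_right ≫ w := by
    refine facesOf_hom_ext fun S hS ↦ ?_
    obtain h | h | h := subset_edge_of_mem hS.1.1 hS.2
    · refine ⟨1, edgeIn _ (vtx k 0) (vtx k 2) (vtx_le k _ _ (by decide)) (hmem _ _ ?_ ?_),
        h.trans (subset_image_edgeIn _ _ _ _ _), ?_⟩
      · exact Or.inl (by simp [mem_facesOmitting, Fin.ext_iff])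
      · exact Or.inl (pair_mem_facesBetween (by simp) (by simp))
      · refine Eq.trans ?_ hw₃.symm
        refine Eq.trans (congrArg (f.app _) (?_ : _ =
          (SSet.horn.{u} (k + 2) 0 : SSet.{u}).σ 0 ((SSet.horn.{u} (k + 2) 0 : SSet.{u}).δ 1 e₀)))
          ((NatTrans.naturality_apply f (SimplexCategory.σ 0).op _).trans
            (congrArg _ (NatTrans.naturality_apply f (SimplexCategory.δ 1).op _)))
        refine Subtype.ext (stdSimplex_ext fun i ↦ ?_)
        fin_cases i <;> rfl
    · refine ⟨1, edgeIn _ (vtx k 1) (vtx k 3) (vtx_le k _ _ (by decide)) (hmem _ _ ?_ ?_),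
        h.trans (subset_image_edgeIn _ _ _ _ _), ?_⟩
      · exact Or.inr ⟨by simp [mem_facesOmitting, Fin.ext_iff],
          by simp [mem_facesOmitting, Fin.ext_iff]⟩
      · exact Or.inr (pair_mem_facesBetween (by simp) (by simp))
      · refine Eq.trans ?_ hw₂.symm
        refine Eq.trans (congrArg (f.app _) (?_ : _ =
          (SSet.horn.{u} (k + 2) 0 : SSet.{u}).σ 0 ((SSet.horn.{u} (k + 2) 0 : SSet.{u}).δ 0 e₀)))
          ((NatTrans.naturality_apply f (SimplexCategory.σ 0).op _).trans
            (congrArg _ (NatTrans.naturality_apply f (SimplexCategory.δ 0).op _)))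
        refine Subtype.ext (stdSimplex_ext fun i ↦ ?_)
        fin_cases i <;> rfl
    · refine ⟨1, edgeIn _ (vtx k 2) (vtx k 3) (vtx_le k _ _ (by decide)) (hmem _ _ ?_ ?_),
        h.trans (subset_image_edgeIn _ _ _ _ _), ?_⟩
      · exact Or.inl (by simp [mem_facesOmitting, Fin.ext_iff])
      · exact Or.inr (pair_mem_facesBetween (by simp) (by simp))
      · refine Eq.trans ?_ hw₁.symm
        refine congrArg (f.app _) (Subtype.ext (stdSimplex_ext fun i ↦ ?_))
        fin_cases i <;> rfl
  obtain ⟨φ₀, hφ₀s, hφ₀w⟩ := exists_glue_facesOf (s ≫ f) w hsw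
  obtain ⟨b₀, hb₀r, hb₀w⟩ := exists_glue_facesOf (r ≫ β) (w ≫ p) (by
    have hle : collapsible k ⊓ facesTriangles k ≤
        (collapsible k ⊓ collapsesToHorn k) ⊓ facesTriangles k :=
      fun S hS ↦ ⟨⟨hS.1, mem_collapsesToHorn_of_facesTriangles k hS.2⟩, hS.2⟩
    have := congrArg (fun z ↦ facesIncl hle ≫ z ≫ p) hsw
    simp only [Category.assoc, hf] at this
    exact this)
  -- Extending in the base to all of `Δ[k + 4]` before any lifting fixes the bottom map of every
  -- later lifting problem.
  obtain ⟨b₁, hb₁⟩ := exists_extension_of_innerAnodyne (innerAnodyne_base₁ k) b₀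
  obtain ⟨b, hb⟩ := exists_extension_of_innerAnodyne (innerAnodyne_base₂ k) b₁
  have hbr : facesIncl le_top ≫ b = r ≫ β := by
    rw [← hb₀r, ← hb₁, ← hb]
    rfl
  have hbw : facesIncl le_top ≫ b = w ≫ p := by
    rw [← hb₀w, ← hb₁, ← hb]
    rfl
  have hφ₀ : φ₀ ≫ p = facesIncl le_top ≫ b := by
    refine facesOf_sup_hom_ext ?_ ?_
    · rw [reassoc_of% hφ₀s, hf, reassoc_of% hs, ← hbr]
      rfl
    · rw [reassoc_of% hφ₀w, ← hbw]
      rfl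
  obtain ⟨φ₁, hφ₁, hφ₁p⟩ := exists_lift_of_innerAnodyne (innerAnodyne_lift₁ k (by
    rintro S (h | h)
    · exact ⟨Or.inl (Or.inl h.1), h.2⟩
    · exact ⟨Or.inl (Or.inr h), mem_collapsesToHorn_of_facesTriangles k h⟩)) hp φ₀ (facesIncl le_top ≫ b) hφ₀
  -- From here on the facet absent from the horn has a lift, namely `φ₂` on the face formed by `1`
  -- and the tail.
  obtain ⟨φ₂, hφ₂, hφ₂p⟩ := exists_lift_of_innerAnodyne (innerAnodyne_lift₂ k (by
    rintro S ⟨-, h | h⟩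
    · exact Or.inl h
    · exact Or.inr h.2)) hp φ₁ (facesIncl le_top ≫ b) hφ₁p
  have hφ₂s {d : SimplexCategoryᵒᵖ} (x : (Δ[k + 4] : SSet.{u}).obj d)
      (h : x ∈ (facesOf (collapsible k ⊓ collapsesToHorn k)).obj d) (h') :
      φ₂.app d ⟨x, h'⟩ = f.app d (s.app d ⟨x, h⟩) :=
    ConcreteCategory.congr_hom (NatTrans.congr_app (show facesIncl
      (show collapsible k ⊓ collapsesToHorn k ≤ facesNotTail k ⊔ facesOmitting (vtx k 3) from
        fun S hS ↦ hS.2.imp id And.right) ≫ φ₂ = s ≫ f by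
        rw [← hφ₀s, ← hφ₁, ← hφ₂]
        rfl) d) ⟨x, h⟩
  have hφ₂b {d : SimplexCategoryᵒᵖ} (x : (Δ[k + 4] : SSet.{u}).obj d) (h) :
      p.app d (φ₂.app d ⟨x, h⟩) = b.app d ⟨x, trivial⟩ :=
    ConcreteCategory.congr_hom (NatTrans.congr_app hφ₂p d) ⟨x, h⟩
  have hbr' {d : SimplexCategoryᵒᵖ} (x : (Δ[k + 4] : SSet.{u}).obj d)
      (h : x ∈ (facesOf (collapsible k)).obj d) :
      b.app d ⟨x, trivial⟩ = β.app d (r.app d ⟨x, h⟩) :=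
    ConcreteCategory.congr_hom (NatTrans.congr_app hbr d) ⟨x, h⟩
  -- extension to the faces omitting `0` and `2`
  let c : (facesOf (facesOmitting (vtx k 0) ⊓ facesOmitting (vtx k 2)) : SSet.{u}) ⟶
      facesOf (facesNotTail k ⊔ facesOmitting (vtx k 3)) :=
    SSet.Subcomplex.lift (vertexMap _ (identify k) fun S hS ↦ monotoneOn_identify hS) (by
      rintro d _ ⟨⟨x, hx⟩, rfl⟩
      refine Or.inr fun h ↦ ?_
      obtain ⟨i, -, hi⟩ := Finset.mem_image.1 h
      exact identify_ne k _ hi)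
  have hc {d : SimplexCategoryᵒᵖ} (x : (Δ[k + 4] : SSet.{u}).obj d) (h) (i) :
    SSet.stdSimplex.asOrderHom (c.app d ⟨x, h⟩).1 i =
      identify k (SSet.stdSimplex.asOrderHom x i) := rfl
  -- Faces omitting `0` and `2` receive the degeneracy of `φ₂` that identifies `3` with `1`. On the
  -- overlap, a face with `3` omits a tail vertex, so there `φ₂` is `f` after the collapse, which
  -- does not separate `1` from `3`; a face without `3` is left unchanged by `identify`.
  obtain ⟨φ₃, hφ₃, hφ₃c⟩ := exists_glue_facesOf φ₂ (c ≫ φ₂) (by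
    ext d ⟨x, hx⟩
    change φ₂.app d ⟨x, hx.1⟩ = φ₂.app d (c.app d ⟨x, hx.2⟩)
    by_cases h3 : vtx k 3 ∈ Finset.univ.image (SSet.stdSimplex.asOrderHom x)
    · have hT : ¬ ContainsTail k _ := hx.1.resolve_right fun h ↦ h h3
      refine (hφ₂s x ⟨Or.inr hx.2, Or.inl hT⟩ _).trans (Eq.trans ?_ (hφ₂s (c.app d ⟨x, hx.2⟩).1 ⟨Or.inr ⟨fun h ↦ ?_, fun h ↦ ?_⟩,
        Or.inl fun h ↦ hT fun i hi ↦ ?_⟩ _).symm)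
      · refine congrArg (f.app d) (Subtype.ext (stdSimplex_ext fun i ↦ ?_))
        exact (collapse_identify k _).symm
      · obtain ⟨i, -, hi⟩ := Finset.mem_image.1 h
        exact identify_ne_of_ne (fun h' ↦ hx.2.1
          (h' ▸ Finset.mem_image_of_mem _ (Finset.mem_univ i))) (by decide) hi
      · obtain ⟨i, -, hi⟩ := Finset.mem_image.1 h
        exact identify_ne_of_ne (fun h' ↦ hx.2.2
          (h' ▸ Finset.mem_image_of_mem _ (Finset.mem_univ i))) (by decide) hi
      · obtain ⟨j, -, hj⟩ := Finset.mem_image.1 (h i hi)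
        exact eq_of_four_le_identify hj hi ▸ Finset.mem_image_of_mem _ (Finset.mem_univ j)
    · refine congrArg (φ₂.app d) (Subtype.ext (stdSimplex_ext fun i ↦ ?_))
      exact (identify_of_ne fun h ↦ h3 (h ▸ Finset.mem_image_of_mem _ (Finset.mem_univ i))).symm)
  have hφ₃p : φ₃ ≫ p = facesIncl le_top ≫ b := by
    refine facesOf_sup_hom_ext ?_ ?_
    · rw [reassoc_of% hφ₃, hφ₂p]
      rfl
    · rw [reassoc_of% hφ₃c, hφ₂p]
      ext d ⟨x, hx⟩
      change b.app d ⟨(c.app d ⟨x, hx⟩).1, trivial⟩ = b.app d ⟨x, trivial⟩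
      rw [hbr' x (Or.inr hx)]
      refine (hbr' _ (Or.inr ⟨fun h ↦ ?_, fun h ↦ ?_⟩)).trans
        (congrArg (β.app d) (stdSimplex_ext fun i ↦ collapse_identify k _))
      · obtain ⟨i, -, hi⟩ := Finset.mem_image.1 h
        exact identify_ne_of_ne (fun h' ↦ hx.1
          (h' ▸ Finset.mem_image_of_mem _ (Finset.mem_univ i))) (by decide) hi
      · obtain ⟨i, -, hi⟩ := Finset.mem_image.1 h
        exact identify_ne_of_ne (fun h' ↦ hx.2
          (h' ▸ Finset.mem_image_of_mem _ (Finset.mem_univ i))) (by decide) hi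
  -- Of the inner horn at `1` on `0, 1, 3` and the tail, the facet opposite `0` comes from the
  -- degeneracy just glued, the others from `φ₂`.
  obtain ⟨φ, hφ, hφp⟩ := exists_lift_of_innerAnodyne (innerAnodyne_lift₃ k
    (sup_le_sup_left inf_le_right _)) hp φ₃ (facesIncl le_top ≫ b) hφ₃p
  let ι : (Δ[k + 2] : SSet.{u}) ⟶ facesOf (facesNotTail k ⊔ facesOmitting (vtx k 3) ⊔
      facesOmitting (vtx k 2)) :=
    SSet.Subcomplex.lift (SSet.stdSimplex.map (SimplexCategory.mkHom
        ⟨expand k, monotone_expand k⟩)) (by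
      rintro d _ ⟨x, rfl⟩
      refine Or.inr fun h ↦ ?_
      obtain ⟨i, -, hi⟩ := Finset.mem_image.1 h
      exact expand_ne_vtx k _ (by simp) hi)
  have hι {d : SimplexCategoryᵒᵖ} (x : (Δ[k + 2] : SSet.{u}).obj d) (i) :
    SSet.stdSimplex.asOrderHom (ι.app d x).1 i = expand k (SSet.stdSimplex.asOrderHom x i) := rfl
  refine ⟨ι ≫ φ, ?_, ?_⟩
  · ext d ⟨x, hx⟩
    have hmem : (ι.app d x).1 ∈ (facesOf (collapsible k ⊓ collapsesToHorn k)).obj d := by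
      have hx' : ¬ (Set.range (SSet.stdSimplex.asOrderHom x) ∪ {0} = Set.univ) := hx
      obtain ⟨j, hj⟩ := (Set.ne_univ_iff_exists_notMem _).1 hx'
      simp only [Set.mem_union, Set.mem_range, Set.mem_singleton_iff, not_or, not_exists] at hj
      have hne (l : Fin (k + 4 + 1)) (hl : l.1 = j.1 + 2) :
          l ∉ Finset.univ.image (SSet.stdSimplex.asOrderHom (ι.app d x).1) := fun h ↦ by
        obtain ⟨i, -, hi⟩ := Finset.mem_image.1 h
        refine hj.1 i ?_
        have hi' := congrArg Fin.val ((hι x i).symm.trans hi)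
        have hj0 : j.1 ≠ 0 := fun h ↦ hj.2 (Fin.ext h)
        simp only [expand] at hi'
        split_ifs at hi'
        · omega
        · exact Fin.ext (by omega)
      refine ⟨Or.inl fun h ↦ ?_, ?_⟩
      · obtain ⟨i, -, hi⟩ := Finset.mem_image.1 h
        exact expand_ne_vtx k _ (by simp) hi
      -- A simplex of the horn omits some `j ≠ 0`, so its image under `expand` omits `j + 2`: the
      -- vertex `3` if `j = 1`, and a tail vertex otherwise.
      · by_cases hj1 : j.1 = 1
        · refine Or.inr ⟨fun h ↦ ?_, hne _ (by simp [hj1])⟩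
          obtain ⟨i, -, hi⟩ := Finset.mem_image.1 h
          exact expand_ne_vtx k _ (by simp) hi
        · have hj0 : j.1 ≠ 0 := fun h ↦ hj.2 (Fin.ext h)
          exact Or.inl fun h ↦ hne ⟨j.1 + 2, by omega⟩ rfl (h _ (by simp; omega))
    have hmem' : (ι.app d x).1 ∈ (facesOf (facesNotTail k ⊔ facesOmitting (vtx k 3))).obj d :=
      hmem.2.imp id And.right
    exact ((ConcreteCategory.congr_hom (NatTrans.congr_app hφ d)
      ⟨(ι.app d x).1, Or.inl hmem'⟩).trans (ConcreteCategory.congr_hom (NatTrans.congr_app hφ₃ d)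
      ⟨(ι.app d x).1, hmem'⟩)).trans ((hφ₂s _ hmem _).trans (congrArg (f.app d)
        (Subtype.ext (a2 := ⟨x, hx⟩) (stdSimplex_ext (y := x) fun i ↦
          collapse_expand k (SSet.stdSimplex.asOrderHom x i)))))
  · ext d x
    refine (ConcreteCategory.congr_hom (NatTrans.congr_app hφp d) (ι.app d x)).trans
      ((hbr' _ (Or.inl fun h ↦ ?_)).trans
        (congrArg (β.app d) (stdSimplex_ext (y := x) fun i ↦
          collapse_expand k (SSet.stdSimplex.asOrderHom x i))))
    obtain ⟨i, -, hi⟩ := Finset.mem_image.1 h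
    exact expand_ne_vtx k _ (by simp) hi

end InfCosmos

namespace InfCosmos

/-! ### Duality -/

lemma hasLiftingProperty_map_iff {C D : Type*} [Category* C] [Category* D] (F : C ⥤ D) [F.Full]
    [F.Faithful] {A B X Y : C} (i : A ⟶ B) (p : X ⟶ Y) :
    HasLiftingProperty (F.map i) (F.map p) ↔ HasLiftingProperty i p := by
  refine ⟨fun h ↦ ⟨fun {f g} sq ↦ ?_⟩, fun h ↦ ⟨fun {f g} sq ↦ ?_⟩⟩
  · have sq' := sq.map F
    exact ⟨⟨⟨F.preimage sq'.lift, F.map_injective (by simp), F.map_injective (by simp)⟩⟩⟩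
  · obtain ⟨f, rfl⟩ := F.map_surjective f
    obtain ⟨g, rfl⟩ := F.map_surjective g
    have sq' : CommSq f i p g := ⟨F.map_injective (by simpa using sq.w)⟩
    exact ⟨⟨⟨F.map sq'.lift, by simp [← F.map_comp], by simp [← F.map_comp]⟩⟩⟩

instance : SSet.opFunctor.{u}.Full := SSet.opEquivalence.{u}.full_functor

instance : SSet.opFunctor.{u}.Faithful := SSet.opEquivalence.{u}.faithful_functor

/-- The opposite of a horn is a horn. -/
noncomputable def hornArrowIsoOp (n : ℕ) (i : Fin (n + 1)) :
    Arrow.mk (SSet.horn.{u} n i.rev).ι ≅ Arrow.mk (SSet.opFunctor.map (SSet.horn.{u} n i).ι) :=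
  Arrow.isoMk (SSet.Subcomplex.eqToIso (SSet.op_horn i).symm ≪≫
      @asIso _ _ _ _ _ (isIso_fromPreimage (SSet.stdSimplex.opIso.{u} ⦋n⦌).inv
        (SSet.horn.{u} n i).op (fun d x _ ↦
          ⟨(SSet.stdSimplex.opIso.{u} ⦋n⦌).hom.app d x, by simp⟩)))
    (SSet.stdSimplex.opIso ⦋n⦌).symm rfl

lemma hasLiftingProperty_horn_op_iff {E B : SSet.{u}} (p : E ⟶ B) (n : ℕ) (i : Fin (n + 1)) :
    HasLiftingProperty (SSet.horn n i.rev).ι (SSet.opFunctor.map p) ↔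
      HasLiftingProperty (SSet.horn n i).ι p := by
  rw [HasLiftingProperty.iff_of_arrow_iso_left (hornArrowIsoOp n i), hasLiftingProperty_map_iff]

lemma innerFibrations_op {E B : SSet.{u}} {p : E ⟶ B} (hp : SSet.innerFibrations p) :
    SSet.innerFibrations (SSet.opFunctor.map p) := by
  rintro _ _ _ ⟨i, h0, hn⟩
  obtain ⟨i, rfl⟩ := Fin.rev_surjective i
  rw [hasLiftingProperty_horn_op_iff]
  refine hp _ (SSet.horn_ι_mem_innerHornInclusions ?_ ?_)
  · rw [Fin.lt_last_iff_ne_last] at hn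
    exact Fin.pos_iff_ne_zero.2 fun h ↦ hn (by rw [h, Fin.rev_zero])
  · exact Fin.lt_last_iff_ne_last.2 fun h ↦ h0.ne' (by rw [h, Fin.rev_last])

lemma quasicategory_op (Q : SSet.{u}) [SSet.Quasicategory Q] : SSet.Quasicategory Q.op := by
  have : SSet.InnerFibration (SSet.opFunctor.map (terminal.from Q)) :=
    ⟨innerFibrations_op (SSet.mem_innerFibrations _)⟩
  have t : IsTerminal (SSet.opFunctor.{u}.obj (⊤_ SSet.{u})) := IsTerminal.isTerminalObj
    SSet.opEquivalence.{u}.functor _ terminalIsTerminal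
  rw [SSet.quasicategory_iff_innerFibration, SSet.innerFibration_iff]
  exact (SSet.innerFibrations.arrow_mk_iso_iff (Arrow.isoMk' (SSet.opFunctor.map (terminal.from Q))
    (terminal.from Q.op) (Iso.refl _) (t.uniqueUpToIso terminalIsTerminal)
      (terminal.hom_ext _ _))).1 this.mem

/-- An inner fibration between quasi-categories lifts against the outer horn at the last vertex if
the edges of its source have inverses. -/
lemma exists_lift_horn_last {E B : SSet.{u}} [SSet.Quasicategory B] (hE : HasEdgeInverses E.op)
    {p : E ⟶ B} (hp : SSet.innerFibrations p) (k : ℕ) :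
    HasLiftingProperty (SSet.horn (k + 2) (Fin.last (k + 2))).ι p := by
  have := quasicategory_op B
  rw [← hasLiftingProperty_horn_op_iff, Fin.rev_last]
  refine ⟨fun {f g} sq ↦ ?_⟩
  obtain ⟨l, h₁, h₂⟩ := exists_lift_horn_zero hE (innerFibrations_op hp) k f g sq.w
  exact ⟨⟨⟨l, h₁, h₂⟩⟩⟩

open SSet.modelCategoryQuillen HomotopicalAlgebra

lemma fibration_iff_horn {E B : SSet.{u}} (p : E ⟶ B) :
    Fibration p ↔ ∀ (n : ℕ) (i : Fin (n + 2)), HasLiftingProperty (SSet.horn (n + 1) i).ι p := by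
  rw [SSet.modelCategoryQuillen.fibration_iff]
  refine ⟨fun h n i ↦ h _ (horn_ι_mem_J (n + 1) i), fun h _ _ _ hf ↦ ?_⟩
  simp only [J, MorphismProperty.iSup_iff] at hf
  obtain ⟨n, ⟨i⟩⟩ := hf
  exact h n i

/-- Inner horns are lifted by `hp`, and outer horns from dimension `2` on through edge inverses on
the appropriate side. Only the horns of dimension `1` remain as a hypothesis. -/
lemma fibration_of_hasEdgeInverses {E B : SSet.{u}} [SSet.Quasicategory B]
    (h₁ : HasEdgeInverses E) (h₂ : HasEdgeInverses E.op) {p : E ⟶ B} (hp : SSet.innerFibrations p)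
    (h : ∀ i : Fin 2, HasLiftingProperty (SSet.horn 1 i).ι p) : Fibration p := by
  rw [fibration_iff_horn]
  rintro (_ | n) i
  · exact h i
  · by_cases h0 : i = 0
    · subst h0
      refine ⟨fun {f g} sq ↦ ?_⟩
      obtain ⟨l, h₁, h₂⟩ := exists_lift_horn_zero h₁ hp n f g sq.w
      exact ⟨⟨⟨l, h₁, h₂⟩⟩⟩
    · by_cases hn : i = Fin.last _
      · subst hn
        exact exists_lift_horn_last h₂ hp n
      · exact hp _ (SSet.horn_ι_mem_innerHornInclusions (Fin.pos_iff_ne_zero.2 h0)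
          (Fin.lt_last_iff_ne_last.2 hn))

/-! ### The homotopy category of a quasi-category -/

lemma yonedaEquiv_δ {X : SSet.{u}} {n : ℕ} (i : Fin (n + 2)) (φ : Δ[n + 1] ⟶ X) :
    X.δ i (SSet.yonedaEquiv φ) = SSet.yonedaEquiv (SSet.stdSimplex.δ i ≫ φ) :=
  SSet.yonedaEquiv_naturality _ _

lemma exists_two_simplex {Q : SSet.{u}} {i j k : Fin 3} (hi : ∀ f : (SSet.horn 2 i : SSet) ⟶ Q,
      ∃ σ : Δ[2] ⟶ Q, f = (SSet.horn 2 i).ι ≫ σ)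
    (hjk : j < k) (hj : j ≠ i) (hk : k ≠ i) (a b : Q _⦋1⦌)
    (hab : Q.δ (k.pred (Fin.ne_zero_of_lt hjk)) a = Q.δ (j.castPred (Fin.ne_last_of_lt hjk)) b) :
    ∃ σ : Q _⦋2⦌, Q.δ j σ = a ∧ Q.δ k σ = b := by
  let f (l : Fin 3) (_ : l ≠ i) : Δ[1] ⟶ Q :=
    SSet.yonedaEquiv.symm (if l = j then a else b)
  have hf : SSet.horn.IsCompatible f := by
    rw [SSet.horn.isCompatible_iff]
    intro j' k' hj' hk' hjk'
    obtain rfl : j' = j := by omega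
    obtain rfl : k' = k := by omega
    simp only [f, if_true, if_neg hjk.ne']
    rw [SSet.stdSimplex.δ_comp_yonedaEquiv_symm, SSet.stdSimplex.δ_comp_yonedaEquiv_symm, hab]
  obtain ⟨φ, hφ⟩ := hf.exists_desc
  obtain ⟨σ, rfl⟩ := hi φ
  have key (l) (hl : l ≠ i) : Q.δ l (SSet.yonedaEquiv σ) = if l = j then a else b := by
    have := hφ l hl
    rw [SSet.horn.ι_ι_assoc] at this
    apply SSet.yonedaEquiv.symm.injective
    rw [← SSet.stdSimplex.δ_comp_yonedaEquiv_symm, Equiv.symm_apply_apply, this]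
  exact ⟨SSet.yonedaEquiv σ, by rw [key j hj, if_pos rfl], by rw [key k hk, if_neg hjk.ne']⟩

lemma δ_δ_apply (Q : SSet.{u}) {n : ℕ} {i j : Fin (n + 2)} (h : i ≤ j) (x : Q _⦋n + 2⦌) :
    Q.δ i (Q.δ j.succ x) = Q.δ j (Q.δ i.castSucc x) :=
  ConcreteCategory.congr_hom (Q.δ_comp_δ h) x

lemma exists_three_simplex_one (Q : SSet.{u}) [SSet.Quasicategory Q] (a₀ a₂ a₃ : Q _⦋2⦌)
    (h₁₂ : Q.δ 2 a₀ = Q.δ 0 a₃)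
    (h₁₃ : Q.δ 1 a₀ = Q.δ 0 a₂) (h₂₃ : Q.δ 2 a₂ = Q.δ 2 a₃) :
    ∃ σ : Q _⦋3⦌, Q.δ 0 σ = a₀ ∧ Q.δ 2 σ = a₂ ∧ Q.δ 3 σ = a₃ := by
  obtain ⟨φ, h₀, h, h₃⟩ := SSet.horn₃₁.exists_desc (SSet.yonedaEquiv.symm a₀)
    (SSet.yonedaEquiv.symm a₂) (SSet.yonedaEquiv.symm a₃)
    (by rw [SSet.stdSimplex.δ_comp_yonedaEquiv_symm, SSet.stdSimplex.δ_comp_yonedaEquiv_symm, h₁₂])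
    (by rw [SSet.stdSimplex.δ_comp_yonedaEquiv_symm, SSet.stdSimplex.δ_comp_yonedaEquiv_symm, h₁₃])
    (by rw [SSet.stdSimplex.δ_comp_yonedaEquiv_symm, SSet.stdSimplex.δ_comp_yonedaEquiv_symm, h₂₃])
  obtain ⟨σ, rfl⟩ := SSet.Quasicategory.hornFilling (by decide) (by decide) φ
  rw [SSet.horn.ι_ι_assoc, SSet.yonedaEquiv.eq_symm_apply, ← yonedaEquiv_δ] at h₀ h h₃
  exact ⟨SSet.yonedaEquiv σ, h₀, h, h₃⟩

lemma exists_three_simplex_two (Q : SSet.{u}) [SSet.Quasicategory Q] (a₀ a₁ a₃ : Q _⦋2⦌)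
    (h₀₂ : Q.δ 2 a₁ = Q.δ 1 a₃)
    (h₁₂ : Q.δ 2 a₀ = Q.δ 0 a₃) (h₂₃ : Q.δ 0 a₀ = Q.δ 0 a₁) :
    ∃ σ : Q _⦋3⦌, Q.δ 0 σ = a₀ ∧ Q.δ 1 σ = a₁ ∧ Q.δ 3 σ = a₃ := by
  obtain ⟨φ, h₀, h, h₃⟩ := SSet.horn₃₂.exists_desc (SSet.yonedaEquiv.symm a₀)
    (SSet.yonedaEquiv.symm a₁) (SSet.yonedaEquiv.symm a₃)
    (by rw [SSet.stdSimplex.δ_comp_yonedaEquiv_symm, SSet.stdSimplex.δ_comp_yonedaEquiv_symm, h₀₂])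
    (by rw [SSet.stdSimplex.δ_comp_yonedaEquiv_symm, SSet.stdSimplex.δ_comp_yonedaEquiv_symm, h₁₂])
    (by rw [SSet.stdSimplex.δ_comp_yonedaEquiv_symm, SSet.stdSimplex.δ_comp_yonedaEquiv_symm, h₂₃])
  obtain ⟨σ, rfl⟩ := SSet.Quasicategory.hornFilling (by decide) (by decide) φ
  rw [SSet.horn.ι_ι_assoc, SSet.yonedaEquiv.eq_symm_apply, ← yonedaEquiv_δ] at h₀ h h₃
  exact ⟨SSet.yonedaEquiv σ, h₀, h, h₃⟩

open SSet.Truncated in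
/-- The `2`-truncation of a quasi-category is a `2`-truncated quasi-category. -/
instance (Q : SSet.{u}) [SSet.Quasicategory Q] :
    Quasicategory₂ ((SSet.truncation 2).obj Q) where
  fill21 {x₀ x₁ x₂} e₀₁ e₁₂ := by
    obtain ⟨σ, h₀, h₂⟩ := exists_two_simplex (Q := Q) (i := 1) (j := 0) (k := 2)
      (SSet.Quasicategory.hornFilling (by decide) (by decide)) (by decide) (by decide) (by decide)
      e₁₂.edge e₀₁.edge (e₁₂.src_eq.trans e₀₁.tgt_eq.symm)
    exact ⟨⟨Q.δ 1 σ, (δ_δ_apply Q (i := 1) (j := 1) le_rfl σ).symm.trans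
        ((congrArg (Q.δ 1) h₂).trans e₀₁.src_eq),
      (δ_δ_apply Q (i := 0) (j := 0) le_rfl σ).trans
        ((congrArg (Q.δ 0) h₀).trans e₁₂.tgt_eq)⟩, ⟨σ, h₂, h₀, rfl⟩⟩
  fill31 {x₀ x₁ x₂ x₃ e₀₁ e₁₂ e₂₃ e₀₂ e₁₃ e₀₃} f₃ f₀ f₂ := by
    obtain ⟨σ, k₀, k₂, k₃⟩ := exists_three_simplex_one Q f₀.simplex f₂.simplex f₃.simplex
      (f₀.d₂.trans f₃.d₀.symm) (f₀.d₁.trans f₂.d₀.symm) (f₂.d₂.trans f₃.d₂.symm)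
    exact ⟨Q.δ 1 σ,
      (δ_δ_apply Q (i := 1) (j := 2) (by decide) _).symm.trans ((congrArg (Q.δ 1) k₃).trans f₃.d₁),
      (δ_δ_apply Q (i := 0) (j := 0) le_rfl _).trans ((congrArg (Q.δ 0) k₀).trans f₀.d₀),
      (δ_δ_apply Q (i := 1) (j := 1) le_rfl _).symm.trans ((congrArg (Q.δ 1) k₂).trans f₂.d₁)⟩
  fill32 {x₀ x₁ x₂ x₃ e₀₁ e₁₂ e₂₃ e₀₂ e₁₃ e₀₃} f₃ f₀ f₁ := by
    obtain ⟨σ, k₀, k₁, k₃⟩ := exists_three_simplex_two Q f₀.simplex f₁.simplex f₃.simplex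
      (f₁.d₂.trans f₃.d₁.symm) (f₀.d₂.trans f₃.d₀.symm) (f₀.d₀.trans f₁.d₀.symm)
    exact ⟨Q.δ 2 σ,
      (δ_δ_apply Q (i := 2) (j := 2) le_rfl _).symm.trans ((congrArg (Q.δ 2) k₃).trans f₃.d₂),
      (δ_δ_apply Q (i := 0) (j := 1) (by decide) _).trans ((congrArg (Q.δ 1) k₀).trans f₀.d₁),
      (δ_δ_apply Q (i := 1) (j := 1) le_rfl _).trans ((congrArg (Q.δ 1) k₁).trans f₁.d₁)⟩

end InfCosmos

/-! ### Joyal's theorem: homotopy groupoids and Kan complexes -/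

namespace InfCosmos

open SSet.Truncated SimplexCategory.Truncated

/-- The comparison between the two constructions of the homotopy category of a quasi-category. -/
noncomputable def homotopyCategoryComparison (Q : SSet.{u}) [SSet.Quasicategory Q] :
    ((SSet.truncation 2).obj Q).HomotopyCategory ⥤ HomotopyCategory₂ ((SSet.truncation 2).obj Q) :=
  HomotopyCategory.lift HomotopyCategory₂.mk HomotopyCategory₂.homMk (fun _ ↦ rfl)
    (fun h ↦ h.homotopyCategory₂_fac)

/-- Invertibility is carried over to `HomotopyCategory₂` because its morphisms are homotopy classes
of single edges and its composition relations are witnessed by `2`-simplices. -/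
lemma isIso_homMk_of_isGroupoid (Q : SSet.{u}) [SSet.Quasicategory Q]
    [IsGroupoid (SSet.hoFunctor.obj Q)] {x y : ((SSet.truncation 2).obj Q).obj (op ⦋0⦌₂)} (e : Edge x y) :
    IsIso (HomotopyCategory₂.homMk e) := by
  have : IsIso (HomotopyCategory.homMk e) :=
    IsGroupoid.all_isIso (C := SSet.hoFunctor.obj Q) (HomotopyCategory.homMk e)
  have := Functor.map_isIso (homotopyCategoryComparison Q) (HomotopyCategory.homMk e)
  exact HomotopyCategory.lift_map_homMk HomotopyCategory₂.mk HomotopyCategory₂.homMk (fun _ ↦ rfl)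
    (fun h ↦ h.homotopyCategory₂_fac) e ▸ this

lemma hasEdgeInverses_of_isGroupoid (Q : SSet.{u}) [SSet.Quasicategory Q]
    [IsGroupoid (SSet.hoFunctor.obj Q)] : HasEdgeInverses Q := by
  intro e
  let e' : Edge (X := (SSet.truncation 2).obj Q) (Q.δ 1 e) (Q.δ 0 e) := ⟨e, rfl, rfl⟩
  have := isIso_homMk_of_isGroupoid Q e'
  obtain ⟨v, hv⟩ := HomotopyCategory₂.homMk_surjective (inv (HomotopyCategory₂.homMk e'))
  obtain ⟨σ⟩ := Edge.CompStruct.nonempty_iff (f := v) (g := e') (h := Edge.id _) |>.2 (by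
    rw [hv, IsIso.inv_hom_id]
    rfl)
  exact ⟨v.edge, σ.simplex, σ.d₂, σ.d₀, σ.d₁⟩

/-- Passing to the opposite exchanges the outer faces of a `2`-simplex, so the composite of `e` and
its inverse is taken in the other order. -/
lemma hasEdgeInverses_op_of_isGroupoid (Q : SSet.{u}) [SSet.Quasicategory Q]
    [IsGroupoid (SSet.hoFunctor.obj Q)] : HasEdgeInverses Q.op := by
  intro (e : Q _⦋1⦌)
  let e' : Edge (X := (SSet.truncation 2).obj Q) (Q.δ 1 e) (Q.δ 0 e) := ⟨e, rfl, rfl⟩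
  have := isIso_homMk_of_isGroupoid Q e'
  obtain ⟨v, hv⟩ := HomotopyCategory₂.homMk_surjective (inv (HomotopyCategory₂.homMk e'))
  obtain ⟨σ⟩ := Edge.CompStruct.nonempty_iff (f := e') (g := v) (h := Edge.id _) |>.2 (by
    rw [hv, IsIso.hom_inv_id]
    rfl)
  refine ⟨SSet.opObjEquiv.symm v.edge, SSet.opObjEquiv.symm σ.simplex, ?_, ?_, ?_⟩
  · rw [SSet.op_δ]
    exact σ.d₀
  · rw [SSet.op_δ]
    exact σ.d₂
  · have h : Q.op.σ 0 (Q.op.δ 0 (SSet.opObjEquiv.symm e)) =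
        SSet.opObjEquiv.symm (Q.σ 0 (Q.δ 1 e)) := by
      rw [SSet.op_δ, SSet.op_σ]
      rfl
    rw [SSet.op_δ]
    exact σ.d₁.trans h.symm

lemma δ_zero_σ_zero (Q : SSet.{u}) (x : Q _⦋0⦌) : Q.δ 0 (Q.σ 0 x) = x :=
  ConcreteCategory.congr_hom (Q.δ_comp_σ_self (i := (0 : Fin 1))) x

lemma δ_one_σ_zero (Q : SSet.{u}) (x : Q _⦋0⦌) : Q.δ 1 (Q.σ 0 x) = x :=
  ConcreteCategory.congr_hom (Q.δ_comp_σ_succ (i := (0 : Fin 1))) x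

/-- Filling the two outer horns of `Δ[2]` formed by an edge and an identity gives a left and a right
inverse of the edge, which then agree. Edges suffice, as they generate the homotopy category. -/
lemma isGroupoid_of_kanComplex (Q : SSet.{u}) [SSet.KanComplex Q] :
    IsGroupoid (SSet.hoFunctor.obj Q) := by
  have key : MorphismProperty.isomorphisms ((SSet.truncation 2).obj Q).HomotopyCategory = ⊤ := by
    refine HomotopyCategory.morphismProperty_eq_top (fun {x y} e ↦ ?_)
    obtain ⟨σ, hσ₁, hσ₂⟩ := exists_two_simplex (Q := Q) (i := 0) (j := 1) (k := 2)
      SSet.KanComplex.hornFilling (by decide) (by decide) (by decide) (Q.σ 0 x) e.edge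
      ((δ_one_σ_zero Q x).trans e.src_eq.symm)
    obtain ⟨τ, hτ₀, hτ₁⟩ := exists_two_simplex (Q := Q) (i := 2) (j := 0) (k := 1)
      SSet.KanComplex.hornFilling (by decide) (by decide) (by decide) e.edge (Q.σ 0 y)
      (e.tgt_eq.trans (δ_zero_σ_zero Q y).symm)
    let v : Edge y x := ⟨Q.δ 0 σ,
      (δ_δ_apply Q (i := 0) (j := 1) (by decide) σ).symm.trans
        ((congrArg (Q.δ 0) hσ₂).trans e.tgt_eq),
      (δ_δ_apply Q (i := 0) (j := 0) le_rfl σ).symm.trans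
        ((congrArg (Q.δ 0) hσ₁).trans (δ_zero_σ_zero Q x))⟩
    let w : Edge y x := ⟨Q.δ 2 τ,
      (δ_δ_apply Q (i := 1) (j := 1) le_rfl τ).trans
        ((congrArg (Q.δ 1) hτ₁).trans (δ_one_σ_zero Q y)),
      (δ_δ_apply Q (i := 0) (j := 1) (by decide) τ).trans
        ((congrArg (Q.δ 1) hτ₀).trans e.src_eq)⟩
    have hv := HomotopyCategory.homMk_comp_homMk (e₀₁ := e) (e₁₂ := v) (e₀₂ := Edge.id x)
      ⟨σ, hσ₂, rfl, hσ₁⟩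
    have hw := HomotopyCategory.homMk_comp_homMk (e₀₁ := w) (e₁₂ := e) (e₀₂ := Edge.id y)
      ⟨τ, rfl, hτ₀, hτ₁⟩
    rw [HomotopyCategory.homMk_id] at hv hw
    have hvw : HomotopyCategory.homMk v = HomotopyCategory.homMk w := by
      rw [← Category.id_comp (HomotopyCategory.homMk v), ← hw, Category.assoc, hv,
        Category.comp_id]
    exact ⟨HomotopyCategory.homMk v, hv, by rw [hvw, hw]⟩
  exact ⟨fun f ↦ (show MorphismProperty.isomorphisms
    ((SSet.truncation 2).obj Q).HomotopyCategory f by rw [key]; trivial)⟩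

open HomotopicalAlgebra SSet.modelCategoryQuillen

lemma hasLiftingProperty_horn_one {E B : SSet.{u}} {p : E ⟶ B} {i j : Fin 2} (hj : j ≠ i)
    (h : HasLiftingProperty (SSet.stdSimplex.δ j : (Δ[0] : SSet.{u}) ⟶ Δ[1]) p) :
    HasLiftingProperty (SSet.horn 1 i).ι p := by
  refine ⟨fun {f g} sq ↦ ?_⟩
  have sq' : CommSq (SSet.horn.ι i j hj ≫ f) (SSet.stdSimplex.δ j) p g :=
    ⟨by rw [Category.assoc, sq.w, SSet.horn.ι_ι_assoc]⟩
  refine ⟨⟨⟨sq'.lift, SSet.horn.hom_ext' fun j' hj' ↦ ?_, sq'.fac_right⟩⟩⟩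
  obtain rfl : j' = j := by omega
  rw [SSet.horn.ι_ι_assoc, sq'.fac_left]

instance quasicategory_terminal : SSet.Quasicategory (⊤_ SSet.{u}) := by
  rw [SSet.quasicategory_iff_innerFibration, SSet.innerFibration_iff]
  have := isIso_of_isTerminal terminalIsTerminal terminalIsTerminal (terminal.from (⊤_ SSet.{u}))
  exact MorphismProperty.of_isIso _ _

/-- The base is the terminal object, over which horns of dimension `1` are filled by degenerate
edges. -/
lemma kanComplex_of_isGroupoid (Q : SSet.{u}) [SSet.Quasicategory Q]
    [IsGroupoid (SSet.hoFunctor.obj Q)] : SSet.KanComplex Q := by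
  refine (isFibrant_iff _).2 (fibration_of_hasEdgeInverses (hasEdgeInverses_of_isGroupoid Q)
    (hasEdgeInverses_op_of_isGroupoid Q) (SSet.mem_innerFibrations _) fun i ↦
      hasLiftingProperty_horn_one (j := i.rev) (by fin_cases i <;> decide)
        ⟨fun {f g} _ ↦ ⟨⟨⟨SSet.stdSimplex.map (SimplexCategory.σ 0) ≫ f, ?_,
          terminal.hom_ext _ _⟩⟩⟩⟩)
  have : SSet.stdSimplex.δ i.rev ≫ SSet.stdSimplex.map (SimplexCategory.σ 0) =
    𝟙 (Δ[0] : SSet.{u}) := SSet.stdSimplex.isTerminalObj₀.hom_ext _ _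
  rw [reassoc_of% this]

lemma isGroupoid_hoFunctor_iff_kanComplex (Q : SSet.{u}) [SSet.Quasicategory Q] :
    IsGroupoid (SSet.hoFunctor.obj Q) ↔ SSet.KanComplex Q :=
  ⟨fun _ ↦ kanComplex_of_isGroupoid Q, fun _ ↦ isGroupoid_of_kanComplex Q⟩

end InfCosmos

namespace InfCosmos

open HomotopicalAlgebra SSet.modelCategoryQuillen

/-! ### The inclusion of the walking arrow into the walking isomorphism is anodyne -/

lemma δ_comp_toPoint (j : Fin 2) :
    SSet.stdSimplex.δ j ≫ SSet.stdSimplex.map (SimplexCategory.σ 0) = 𝟙 (Δ[0] : SSet.{u}) :=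
  SSet.stdSimplex.isTerminalObj₀.hom_ext _ _

lemma anodyneExtensions_δ (j : Fin 2) :
    SSet.anodyneExtensions (SSet.stdSimplex.δ j : (Δ[0] : SSet.{u}) ⟶ Δ[1]) := by
  intro E B p hp
  rw [← HomotopicalAlgebra.fibration_iff, fibration_iff_horn] at hp
  have hj : j ≠ j.rev := by fin_cases j <;> decide
  have := hp 0 j.rev
  refine ⟨fun {f g} sq ↦ ?_⟩
  have sq' : CommSq ((SSet.horn 1 j.rev).ι ≫ SSet.stdSimplex.map (SimplexCategory.σ 0) ≫ f)
      (SSet.horn 1 j.rev).ι p g := ⟨SSet.horn.hom_ext' fun j' hj' ↦ by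
    obtain rfl : j' = j := by omega
    rw [Category.assoc, SSet.horn.ι_ι_assoc, Category.assoc, reassoc_of% δ_comp_toPoint, sq.w,
      SSet.horn.ι_ι_assoc]⟩
  refine ⟨⟨⟨sq'.lift, ?_, sq'.fac_right⟩⟩⟩
  rw [← SSet.horn.ι_ι _ _ hj, Category.assoc, sq'.fac_left, SSet.horn.ι_ι_assoc,
    reassoc_of% δ_comp_toPoint]

/-- The `i`th vertex of a simplex of the walking isomorphism. -/
def isoVertex {d : SimplexCategoryᵒᵖ} (s : SSet.coherentIso.{u}.obj d)
    (i : Fin (d.unop.len + 1)) : Bool :=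
  (Codiscrete.equivFun (n := d.unop.len) s i).down

/-- The simplex of the walking isomorphism with given vertices. -/
def isoMk {d : SimplexCategoryᵒᵖ} (s : Fin (d.unop.len + 1) → Bool) : SSet.coherentIso.{u}.obj d :=
  (Codiscrete.equivFun (n := d.unop.len)).symm (fun i ↦ ⟨s i⟩)

lemma coherentIso_ext {d : SimplexCategoryᵒᵖ} {s t : SSet.coherentIso.{u}.obj d}
    (h : ∀ i, isoVertex s i = isoVertex t i) : s = t :=
  (Codiscrete.equivFun (n := d.unop.len)).injective
    (funext fun i ↦ congrArg ULift.up (h i))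

lemma isoVertex_arrowToIso {d : SimplexCategoryᵒᵖ} (x : (Δ[1] : SSet.{u}).obj d) (i) :
    isoVertex (arrowToIso.{u}.app d x) i =
      decide (SSet.stdSimplex.asOrderHom x i = (1 : Fin 2)) := by
  have (a : Fin 2) : isoVertex (d := op ⦋1⦌) SSet.coherentIso.hom.{u}.edge a = decide (a = 1) := by
    fin_cases a <;> rfl
  exact this _

instance mono_arrowToIso : Mono arrowToIso.{u} := by
  have (d : SimplexCategoryᵒᵖ) : Mono (arrowToIso.{u}.app d) := by
    rw [mono_iff_injective]
    refine fun x y hxy ↦ stdSimplex_ext fun i ↦ ?_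
    have := congrArg (fun s ↦ isoVertex s i) hxy
    simp only [isoVertex_arrowToIso, decide_eq_decide] at this
    generalize SSet.stdSimplex.asOrderHom x i = a at *
    generalize SSet.stdSimplex.asOrderHom y i = b at *
    change Fin 2 at a b
    omega
  exact NatTrans.mono_of_mono_app _

/-- The contraction of the walking isomorphism to its source. -/
def isoContraction : SSet.coherentIso.{u} ⊗ Δ[1] ⟶ SSet.coherentIso.{u} where
  app _ := ↾ fun x ↦ isoMk fun i ↦
    isoVertex x.1 i && decide (SSet.stdSimplex.asOrderHom x.2 i = (1 : Fin 2))
  naturality _ _ _ := rfl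

/-- The contraction of the arrow to its source. -/
def arrowContraction : (Δ[1] : SSet.{u}) ⊗ Δ[1] ⟶ Δ[1] where
  app _ := ↾ fun x ↦ SSet.stdSimplex.objEquiv.symm (SimplexCategory.mkHom
    ⟨fun i ↦ min (SSet.stdSimplex.asOrderHom x.1 i) (SSet.stdSimplex.asOrderHom x.2 i),
      fun _ _ hij ↦ min_le_min ((SSet.stdSimplex.asOrderHom x.1).monotone hij)
        ((SSet.stdSimplex.asOrderHom x.2).monotone hij)⟩)
  naturality _ _ _ := rfl

lemma asOrderHom_δ (j : Fin 2) {d : SimplexCategoryᵒᵖ} (x : (Δ[0] : SSet.{u}).obj d) (i) :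
    SSet.stdSimplex.asOrderHom ((SSet.stdSimplex.δ j : Δ[0] ⟶ (Δ[1] : SSet.{u})).app d x) i =
      (j.rev : Fin 2) := by
  have (a : Fin 1) : (SimplexCategory.δ j).toOrderHom a = j.rev := by
    fin_cases a; fin_cases j <;> rfl
  exact this _

lemma asOrderHom_arrowContraction {d : SimplexCategoryᵒᵖ} (x : ((Δ[1] : SSet.{u}) ⊗ Δ[1]).obj d)
    (i) : SSet.stdSimplex.asOrderHom (arrowContraction.app d x) i =
      min (SSet.stdSimplex.asOrderHom x.1 i) (SSet.stdSimplex.asOrderHom x.2 i) := rfl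

lemma isoVertex_isoContraction {d : SimplexCategoryᵒᵖ} (x : (SSet.coherentIso.{u} ⊗ Δ[1]).obj d)
    (i) : isoVertex (isoContraction.app d x) i =
      (isoVertex x.1 i && decide (SSet.stdSimplex.asOrderHom x.2 i = (1 : Fin 2))) := rfl

/-- The map is a retract of its pushout-product with the vertex `0` of `Δ[1]`, which is anodyne. The
retraction contracts `𝕀` to its source by taking minima with the coordinate in `Δ[1]`; this
preserves the arrow, is constant at time `0` and is the identity at time `1`. -/
lemma anodyneExtensions_arrowToIso : SSet.anodyneExtensions arrowToIso.{u} := by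
  let sq := Functor.PushoutObjObj.ofHasPushout (curriedTensor SSet.{u}) arrowToIso.{u}
    (SSet.stdSimplex.δ 1 : Δ[0] ⟶ Δ[1])
  -- `δ b` omits the vertex `b`, so `c 1` is the vertex `0` and `c 0` is the vertex `1`.
  let c (b : Fin 2) : Δ[0] ⟶ (Δ[1] : SSet.{u}) := SSet.stdSimplex.δ b
  let t (X : SSet.{u}) : X ⟶ Δ[0] := SSet.stdSimplex.isTerminalObj₀.from X
  have ht {X Y : SSet.{u}} (f : X ⟶ Y) : f ≫ t Y = t X :=
    SSet.stdSimplex.isTerminalObj₀.hom_ext _ _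
  have h₂ : arrowToIso.{u} ▷ Δ[0] ≫ t _ ≫ c 1 = Δ[1] ◁ c 1 ≫ arrowContraction := by
    ext d x
    refine stdSimplex_ext fun i ↦ ?_
    refine (asOrderHom_δ 1 _ i).trans ((asOrderHom_arrowContraction (d := d) _ i).trans ?_).symm
    refine (congrArg (min _) (asOrderHom_δ 1 _ i)).trans ?_
    have (a : Fin 2) : min a (Fin.rev 1) = Fin.rev 1 := by decide +revert
    exact this _
  have h₃ : t _ ≫ c 1 ≫ arrowToIso.{u} = SSet.coherentIso.{u} ◁ c 1 ≫ isoContraction := by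
    ext d x : 4
    refine coherentIso_ext fun i ↦ (isoVertex_arrowToIso _ i).trans ?_
    refine ((congrArg (fun a : Fin 2 ↦ decide (a = 1)) (asOrderHom_δ 1 _ i)).trans ?_).trans
      (isoVertex_isoContraction (d := d) _ i).symm
    refine (((congrArg (fun a : Fin 2 ↦ _ && decide (a = 1)) (asOrderHom_δ 1 _ i))).trans ?_).symm
    simp
  have h₄ : arrowContraction ≫ arrowToIso.{u} = arrowToIso.{u} ▷ Δ[1] ≫ isoContraction := by
    ext d x : 4
    refine coherentIso_ext fun i ↦ (isoVertex_arrowToIso _ i).trans ?_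
    refine Eq.trans ?_ (isoVertex_isoContraction (d := d) _ i).symm
    refine Eq.trans ?_ (congrArg (· && _) (isoVertex_arrowToIso (d := d) _ i).symm)
    have (a b : Fin 2) : decide (min a b = 1) = (decide (a = 1) && decide (b = 1)) := by
      decide +revert
    exact this _ _
  refine MorphismProperty.of_retract (P := SSet.anodyneExtensions) (g := sq.ι)
    { i := Arrow.homMk (CartesianMonoidalCategory.lift (𝟙 _) (t _ ≫ c 0) ≫ sq.inr)
        (CartesianMonoidalCategory.lift (𝟙 _) (t _ ≫ c 0)) ?_
      r := Arrow.homMk (sq.isPushout.desc (t _ ≫ c 1) arrowContraction h₂) isoContraction ?_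
      retract := ?_ } (SSet.anodyneExtensions_pushoutObjObjι sq (anodyneExtensions_δ 1))
  · dsimp only [Arrow.mk_left, Arrow.mk_right, Arrow.mk_hom]
    refine (Category.assoc _ _ _).trans ((congrArg _ sq.inr_ι).trans ?_)
    simp [reassoc_of% ht]
  · refine sq.hom_ext ?_ ?_
    · refine (sq.isPushout.inl_desc_assoc _ _ _ _).trans ?_
      refine ((Category.assoc _ _ _).trans h₃).trans ?_
      exact (congrArg (· ≫ isoContraction) sq.inl_ι.symm).trans (Category.assoc _ _ _)
    · refine (sq.isPushout.inr_desc_assoc _ _ _ _).trans ?_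
      refine h₄.trans ?_
      exact (congrArg (· ≫ isoContraction) sq.inr_ι.symm).trans (Category.assoc _ _ _)
  · ext1
    · refine (Category.assoc _ _ _).trans ((congrArg _ (sq.isPushout.inr_desc _ _ _)).trans ?_)
      ext d x
      refine stdSimplex_ext fun i ↦ (asOrderHom_arrowContraction (d := d) _ i).trans ?_
      refine (congrArg (min _) (asOrderHom_δ 0 _ i)).trans ?_
      exact min_eq_left (Fin.le_last (n := 1) _)
    · ext d x
      refine coherentIso_ext fun i ↦ (isoVertex_isoContraction (d := d) _ i).trans ?_
      refine (congrArg (fun a : Fin 2 ↦ _ && decide (a = 1)) (asOrderHom_δ 0 _ i)).trans ?_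
      exact Bool.and_true _

end InfCosmos

namespace InfCosmos

open HomotopicalAlgebra SSet.modelCategoryQuillen

/-! ### Kan complexes, isofibrations and equivalences -/

lemma exists_extension_of_anodyne {A B Q : SSet.{u}} [SSet.KanComplex Q] {i : A ⟶ B}
    (hi : SSet.anodyneExtensions i) (f : A ⟶ Q) : ∃ g : B ⟶ Q, i ≫ g = f := by
  have : Fibration (terminal.from Q) := (isFibrant_iff _).1 ‹SSet.KanComplex Q›
  have := hi (terminal.from Q) (by rwa [← HomotopicalAlgebra.fibration_iff])
  have sq : CommSq f i (terminal.from Q) (terminal.from B) := ⟨terminal.hom_ext _ _⟩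
  exact ⟨sq.lift, sq.fac_left⟩

lemma δ_one_arrowToIso : SSet.stdSimplex.δ 1 ≫ arrowToIso.{u} =
    (SSet.yonedaEquiv.symm SSet.coherentIso.x₀ : Δ[0] ⟶ SSet.coherentIso.{u}) := by
  refine SSet.yonedaEquiv.injective (coherentIso_ext (d := op ⦋0⦌) fun i ↦ ?_)
  fin_cases i
  rfl

lemma δ_zero_arrowToIso : SSet.stdSimplex.δ 0 ≫ arrowToIso.{u} =
    (SSet.yonedaEquiv.symm SSet.coherentIso.x₁ : Δ[0] ⟶ SSet.coherentIso.{u}) := by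
  refine SSet.yonedaEquiv.injective (coherentIso_ext (d := op ⦋0⦌) fun i ↦ ?_)
  fin_cases i
  rfl

lemma fibration_of_isQCatIsofibration {E B : SSet.{u}} [SSet.KanComplex E] [SSet.KanComplex B]
    {p : E ⟶ B} (hp : IsQCatIsofibration p) : Fibration p := by
  have := isGroupoid_of_kanComplex E
  refine fibration_of_hasEdgeInverses (hasEdgeInverses_of_isGroupoid E)
    (hasEdgeInverses_op_of_isGroupoid E) hp.inner fun i ↦
      hasLiftingProperty_horn_one (j := i.rev) (by fin_cases i <;> decide) ⟨fun {f g} sq ↦ ?_⟩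
  -- Since `B` is a Kan complex, the edge to be lifted extends to `𝕀`, where the lifting property of
  -- isofibrations applies.
  obtain ⟨g, rfl⟩ := exists_extension_of_anodyne anodyneExtensions_arrowToIso g
  have : HasLiftingProperty (SSet.stdSimplex.δ i.rev ≫ arrowToIso) p := by
    fin_cases i
    · exact δ_one_arrowToIso ▸ hp.lift_zero
    · exact δ_zero_arrowToIso ▸ hp.lift_one
  have sq' : CommSq f (SSet.stdSimplex.δ i.rev ≫ arrowToIso) p g := ⟨by simpa using sq.w⟩
  exact ⟨⟨⟨arrowToIso ≫ sq'.lift, by rw [← Category.assoc, sq'.fac_left], by simp⟩⟩⟩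

lemma IsoHomotopic.refl {A B : SSet.{u}} (f : A ⟶ B) : IsoHomotopic f f :=
  ⟨CartesianMonoidalCategory.fst _ _ ≫ f, by simp [atVertex], by simp [atVertex]⟩

/-- The union of the two ends of the cylinder on `X` given by the walking isomorphism. -/
def cylinderEnds (X : SSet.{u}) : (X ⊗ SSet.coherentIso.{u}).Subcomplex where
  obj _ := Set.ofPred fun z ↦ ∀ i j, isoVertex z.2 i = isoVertex z.2 j
  map _ _ h _ _ := h _ _

open Classical in
/-- The map from the ends of the cylinder on `X` given by two maps. -/
noncomputable def cylinderEndsDesc {X Y : SSet.{u}} (f g : X ⟶ Y) :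
    (cylinderEnds X : SSet) ⟶ Y where
  app d := ↾ fun z ↦ if isoVertex z.1.2 0 = true then g.app d z.1.1 else f.app d z.1.1
  naturality d e φ := by
    ext z
    have : isoVertex ((cylinderEnds X : SSet).map φ z).1.2 0 = isoVertex z.1.2 0 := z.2 _ _
    by_cases h : isoVertex z.1.2 0 = true
    · exact (if_pos (this.trans h)).trans ((ConcreteCategory.congr_hom (g.naturality φ) z.1.1).trans
        (congrArg (Y.map φ) (if_pos h).symm))
    · exact (if_neg (this.trans_ne h)).trans
        ((ConcreteCategory.congr_hom (f.naturality φ) z.1.1).trans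
          (congrArg (Y.map φ) (if_neg h).symm))

/-- Lifting against `∅ ⟶ Y` gives a section. Lifting against the two ends of `X × 𝕀`, over the
constant homotopy on `p`, gives the homotopy on `X`; the one on `Y` is constant. -/
lemma isQCatEquivalence_of_rlp {X Y : SSet.{u}} {p : X ⟶ Y}
    (hp : (MorphismProperty.monomorphisms SSet.{u}).rlp p) : IsQCatEquivalence p := by
  have h₀ := hp (initial.to Y) (by
    exact (inferInstance : Mono (initial.to Y)))
  have sq₀ : CommSq (initial.to X) (initial.to Y) p (𝟙 Y) := ⟨by simp⟩
  have h₁ := hp (cylinderEnds X).ι (inferInstance : Mono _)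
  have sq₁ : CommSq (cylinderEndsDesc (𝟙 X) (p ≫ sq₀.lift)) (cylinderEnds X).ι p
      (CartesianMonoidalCategory.fst _ _ ≫ p) := ⟨by
    ext d z
    have h : p.app d (sq₀.lift.app d (p.app d z.1.1)) = p.app d z.1.1 :=
      ConcreteCategory.congr_hom (NatTrans.congr_app sq₀.fac_right d) _
    change p.app d (if _ then _ else _) = p.app d z.1.1
    split_ifs
    · exact h
    · rfl⟩
  have key (x : SSet.coherentIso.{u} _⦋0⦌) : atVertex X x ≫ sq₁.lift = SSet.Subcomplex.lift
      (atVertex X x) (by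
        rintro d _ ⟨y, rfl⟩ i j
        rfl) ≫ cylinderEndsDesc (𝟙 X) (p ≫ sq₀.lift) :=
    congrArg (SSet.Subcomplex.lift (atVertex X x) _ ≫ ·) sq₁.fac_left
  refine ⟨sq₀.lift, ⟨sq₁.lift, ?_, ?_⟩, ?_⟩
  · rw [key]
    rfl
  · rw [key]
    rfl
  · rw [sq₀.fac_right]
    exact .refl _

/-- By adjunction, lifting a monomorphism `j` against `Q ^ V ⟶ Q ^ U` amounts to extending maps to
`Q` along the pushout-product of `i` and `j`, which is anodyne. -/
lemma rlp_pre_app {U V Q : SSet.{u}} [SSet.KanComplex Q] {i : U ⟶ V}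
    (hi : SSet.anodyneExtensions i) :
    (MorphismProperty.monomorphisms SSet.{u}).rlp ((MonoidalClosed.pre i).app Q) := by
  intro A B j (hj : Mono j)
  have : Fibration (terminal.from Q) := (isFibrant_iff _).1 ‹SSet.KanComplex Q›
  rw [HomotopicalAlgebra.fibration_iff] at this
  let sq := Functor.PushoutObjObj.ofHasPushout (curriedTensor SSet.{u}) i j
  exact (MonoidalClosed.internalHomAdjunction₂.hasLiftingProperty_iff sq
    (Functor.PullbackObjObj.ofIsTerminal MonoidalClosed.internalHom i (terminal.from Q)
      terminalIsTerminal)).1 (SSet.anodyneExtensions_pushoutObjObjι' sq hi _ this)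

/-- An extension of an edge to `𝕀` supplies an inverse edge together with both `2`-simplices that
witness it. -/
lemma isGroupoid_of_exists_extension {Q : SSet.{u}}
    (h : ∀ e : Δ[1] ⟶ Q, ∃ γ : SSet.coherentIso.{u} ⟶ Q, arrowToIso ≫ γ = e) :
    IsGroupoid (SSet.hoFunctor.obj Q) := by
  open SSet.Truncated SimplexCategory.Truncated in
  have key : MorphismProperty.isomorphisms ((SSet.truncation 2).obj Q).HomotopyCategory = ⊤ := by
    refine HomotopyCategory.morphismProperty_eq_top (fun {x y} e ↦ ?_)
    obtain ⟨γ, hγ⟩ := h (SSet.yonedaEquiv.symm e.edge)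
    let f : SSet.Edge (X := Q) x y := ⟨e.edge, e.src_eq, e.tgt_eq⟩
    let I : f.InvStruct := SSet.coherentIso.invStructOfEqMapHom (g := γ) (by
      refine (SSet.yonedaEquiv.apply_symm_apply e.edge).symm.trans
        ((congrArg SSet.yonedaEquiv hγ).symm.trans ?_)
      rw [SSet.yonedaEquiv_comp, arrowToIso, Equiv.apply_symm_apply])
    let v : Edge (X := (SSet.truncation 2).obj Q) y x := ⟨I.inv.edge, I.inv.src_eq, I.inv.tgt_eq⟩
    refine ⟨HomotopyCategory.homMk v, ?_, ?_⟩
    · refine (HomotopyCategory.homMk_comp_homMk (e₀₁ := e) (e₁₂ := v) (e₀₂ := Edge.id x)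
        ⟨I.homInvId.simplex, I.homInvId.d₂, I.homInvId.d₀, I.homInvId.d₁⟩).trans ?_
      rw [HomotopyCategory.homMk_id]
    · refine (HomotopyCategory.homMk_comp_homMk (e₀₁ := v) (e₁₂ := e) (e₀₂ := Edge.id y)
        ⟨I.invHomId.simplex, I.invHomId.d₂, I.invHomId.d₀, I.invHomId.d₁⟩).trans ?_
      rw [HomotopyCategory.homMk_id]
  exact ⟨fun f ↦ (show MorphismProperty.isomorphisms
    ((SSet.truncation 2).obj Q).HomotopyCategory f by rw [key]; trivial)⟩

lemma yonedaEquiv_symm_comp_lift {B : SSet.{u}} (b : Δ[0] ⟶ B) (x : SSet.coherentIso.{u} _⦋0⦌) :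
    SSet.yonedaEquiv.symm x ≫ CartesianMonoidalCategory.lift
      (SSet.stdSimplex.isTerminalObj₀.from SSet.coherentIso ≫ b) (𝟙 _) = b ≫ atVertex B x := by
  refine CartesianMonoidalCategory.hom_ext _ _ ?_ ?_
  · rw [Category.assoc, CartesianMonoidalCategory.lift_fst, Category.assoc, atVertex,
      CartesianMonoidalCategory.lift_fst, Category.comp_id, ← Category.assoc,
      SSet.stdSimplex.isTerminalObj₀.hom_ext (_ ≫ _) (𝟙 Δ[0]), Category.id_comp]
  · rw [Category.assoc, CartesianMonoidalCategory.lift_snd, Category.assoc, atVertex,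
      CartesianMonoidalCategory.lift_snd, Category.comp_id, SSet.comp_const,
      SSet.yonedaEquiv_symm_zero]

/-- The homotopy `H` gives a path over `𝕀` in `B` from the image of `g b` to `b`. An isofibration
lifts it from `g b`, and the lift ends over `b`. -/
lemma exists_lift_of_isQCatEquivalence {E B : SSet.{u}} {p : E ⟶ B} (hp : IsQCatIsofibration p)
    (hp' : IsQCatEquivalence p) (b : Δ[0] ⟶ B) : ∃ e : Δ[0] ⟶ E, e ≫ p = b := by
  obtain ⟨g, -, H, h₀, h₁⟩ := hp'
  have := hp.lift_zero
  have sq : CommSq (b ≫ g) (SSet.yonedaEquiv.symm SSet.coherentIso.x₀ :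
    Δ[0] ⟶ SSet.coherentIso.{u}) p
      (CartesianMonoidalCategory.lift (SSet.stdSimplex.isTerminalObj₀.from _ ≫ b) (𝟙 _) ≫ H) :=
    ⟨by
      rw [Category.assoc, ← h₀, ← Category.assoc, ← Category.assoc, yonedaEquiv_symm_comp_lift]⟩
  refine ⟨(SSet.yonedaEquiv.symm SSet.coherentIso.x₁ :
    Δ[0] ⟶ SSet.coherentIso.{u}) ≫ sq.lift, ?_⟩
  rw [Category.assoc, sq.fac_right]
  rw [← Category.assoc, yonedaEquiv_symm_comp_lift, Category.assoc, h₁, Category.comp_id]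

/-- If `Q ^ 𝕀 ⟶ Q ^ 𝟚` is a trivial fibration, then the homotopy category of `Q` is a groupoid. -/
lemma isGroupoid_of_isQCatEquivalence {Q : SSet.{u}}
    (hp : IsQCatIsofibration ((MonoidalClosed.pre arrowToIso.{u}).app Q))
    (hp' : IsQCatEquivalence ((MonoidalClosed.pre arrowToIso.{u}).app Q)) :
    IsGroupoid (SSet.hoFunctor.obj Q) := by
  refine isGroupoid_of_exists_extension fun e ↦ ?_
  obtain ⟨γ, hγ⟩ := exists_lift_of_isQCatEquivalence hp hp'
    (MonoidalClosed.curry (CartesianMonoidalCategory.fst _ _ ≫ e))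
  refine ⟨CartesianMonoidalCategory.lift (𝟙 _) (SSet.stdSimplex.isTerminalObj₀.from _) ≫
    MonoidalClosed.uncurry γ, ?_⟩
  have := congrArg MonoidalClosed.uncurry hγ
  rw [MonoidalClosed.uncurry_curry, MonoidalClosed.uncurry_pre_app] at this
  have h : arrowToIso.{u} ≫ CartesianMonoidalCategory.lift (𝟙 _)
      (SSet.stdSimplex.isTerminalObj₀.from _) = CartesianMonoidalCategory.lift (𝟙 _)
        (SSet.stdSimplex.isTerminalObj₀.from _) ≫ arrowToIso ▷ Δ[0] :=
    CartesianMonoidalCategory.hom_ext _ _ (by simp) (SSet.stdSimplex.isTerminalObj₀.hom_ext _ _)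
  rw [← Category.assoc, h, Category.assoc, this, CartesianMonoidalCategory.lift_fst_assoc,
    Category.id_comp]

end InfCosmos

namespace InfCosmos

/-! ### Paths parametrised by the walking isomorphism -/

/-- Two vertices are connected by a path parametrised by the walking isomorphism. -/
def IsoPath {Q : SSet.{u}} (x y : Q _⦋0⦌) : Prop :=
  ∃ γ : SSet.coherentIso.{u} ⟶ Q,
    γ.app _ SSet.coherentIso.x₀ = x ∧ γ.app _ SSet.coherentIso.x₁ = y

lemma IsoPath.map {P Q : SSet.{u}} (φ : P ⟶ Q) {x y : P _⦋0⦌} (h : IsoPath x y) :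
    IsoPath (φ.app _ x) (φ.app _ y) := by
  obtain ⟨γ, rfl, rfl⟩ := h
  exact ⟨γ ≫ φ, rfl, rfl⟩

lemma IsoHomotopic.isoPath {A B : SSet.{u}} {f g : A ⟶ B} (h : IsoHomotopic f g) (a : A _⦋0⦌) :
    IsoPath (f.app _ a) (g.app _ a) := by
  obtain ⟨H, rfl, rfl⟩ := h
  have (x : SSet.coherentIso.{u} _⦋0⦌) :
      (CartesianMonoidalCategory.lift (SSet.const a) (𝟙 _) ≫ H).app _ x =
        (atVertex A x ≫ H).app _ a := by
    have h {X : SSet.{u}} (φ : op ⦋0⦌ ⟶ op ⦋0⦌) (y : X _⦋0⦌) : X.map φ y = y := by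
      obtain rfl : φ = 𝟙 _ := Quiver.Hom.unop_inj (SimplexCategory.isTerminalZero.hom_ext _ _)
      exact X.map_id_apply _ y
    exact congrArg (H.app (op ⦋0⦌)) (Prod.ext (h _ a) (h _ x).symm)
  exact ⟨CartesianMonoidalCategory.lift (SSet.const a) (𝟙 _) ≫ H, this _, this _⟩

/-- In a Kan complex an edge extends along the anodyne map `arrowToIso`. Paths can therefore be
reversed and composed by filling horns of `Δ[2]`. -/
lemma isoPath_iff_exists_edge {Q : SSet.{u}} [SSet.KanComplex Q] (x y : Q _⦋0⦌) :
    IsoPath x y ↔ ∃ e : Q _⦋1⦌, Q.δ 1 e = x ∧ Q.δ 0 e = y := by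
  have h (γ : SSet.coherentIso.{u} ⟶ Q) (e : Q _⦋1⦌)
      (he : SSet.yonedaEquiv (arrowToIso ≫ γ) = e) :
      γ.app _ SSet.coherentIso.x₀ = Q.δ 1 e ∧ γ.app _ SSet.coherentIso.x₁ = Q.δ 0 e := by
    subst he
    have h₁ := yonedaEquiv_δ 1 (arrowToIso ≫ γ)
    have h₀ := yonedaEquiv_δ 0 (arrowToIso ≫ γ)
    rw [← Category.assoc, δ_one_arrowToIso] at h₁
    rw [← Category.assoc, δ_zero_arrowToIso] at h₀
    have h (z : SSet.coherentIso.{u} _⦋0⦌) :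
        SSet.yonedaEquiv (SSet.yonedaEquiv.symm z ≫ γ) = γ.app _ z := by
      rw [SSet.yonedaEquiv_comp, Equiv.apply_symm_apply]
    exact ⟨(h₁.trans (h _)).symm, (h₀.trans (h _)).symm⟩
  constructor
  · rintro ⟨γ, rfl, rfl⟩
    exact ⟨_, (h γ _ rfl).1.symm, (h γ _ rfl).2.symm⟩
  · rintro ⟨e, rfl, rfl⟩
    obtain ⟨γ, hγ⟩ := exists_extension_of_anodyne anodyneExtensions_arrowToIso
      (SSet.yonedaEquiv.symm e)
    exact ⟨γ, h γ e (by rw [hγ, Equiv.apply_symm_apply])⟩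

lemma IsoPath.symm {Q : SSet.{u}} [SSet.KanComplex Q] {x y : Q _⦋0⦌} (h : IsoPath x y) :
    IsoPath y x := by
  rw [isoPath_iff_exists_edge] at h ⊢
  obtain ⟨e, rfl, rfl⟩ := h
  obtain ⟨σ, hσ₁, hσ₂⟩ := exists_two_simplex (Q := Q) (i := 0) (j := 1) (k := 2)
    SSet.KanComplex.hornFilling (by decide) (by decide) (by decide) (Q.σ 0 (Q.δ 1 e)) e
    (δ_one_σ_zero Q _)
  refine ⟨Q.δ 0 σ, ?_, ?_⟩
  · exact (δ_δ_apply Q (i := 0) (j := 1) (by decide) σ).symm.trans (congrArg (Q.δ 0) hσ₂)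
  · exact (δ_δ_apply Q (i := 0) (j := 0) le_rfl σ).symm.trans
      ((congrArg (Q.δ 0) hσ₁).trans (δ_zero_σ_zero Q _))

lemma IsoPath.trans {Q : SSet.{u}} [SSet.KanComplex Q] {x y z : Q _⦋0⦌} (h : IsoPath x y)
    (h' : IsoPath y z) : IsoPath x z := by
  rw [isoPath_iff_exists_edge] at h h' ⊢
  obtain ⟨e, rfl, rfl⟩ := h
  obtain ⟨f, hf, rfl⟩ := h'
  obtain ⟨σ, hσ₀, hσ₂⟩ := exists_two_simplex (Q := Q) (i := 1) (j := 0) (k := 2)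
    SSet.KanComplex.hornFilling (by decide) (by decide) (by decide) f e hf
  refine ⟨Q.δ 1 σ, ?_, ?_⟩
  · exact (δ_δ_apply Q (i := 1) (j := 1) le_rfl σ).symm.trans (congrArg (Q.δ 1) hσ₂)
  · exact (δ_δ_apply Q (i := 0) (j := 0) le_rfl σ).trans (congrArg (Q.δ 0) hσ₀)

lemma IsoHomotopic.whisker {A B A' B' : SSet.{u}} {f g : A ⟶ B} (h : IsoHomotopic f g)
    (a : A' ⟶ A) (b : B ⟶ B') : IsoHomotopic (a ≫ f ≫ b) (a ≫ g ≫ b) := by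
  obtain ⟨H, rfl, rfl⟩ := h
  have (x : SSet.coherentIso.{u} _⦋0⦌) : atVertex A' x ≫ a ▷ _ = a ≫ atVertex A x :=
    CartesianMonoidalCategory.hom_ext _ _ (by simp [atVertex]) (by simp [atVertex])
  exact ⟨a ▷ _ ≫ H ≫ b, by rw [reassoc_of% this, Category.assoc],
    by rw [reassoc_of% this, Category.assoc]⟩

lemma IsQCatEquivalence.of_iso {A B A' B' : SSet.{u}} {f : A ⟶ B} {f' : A' ⟶ B'} (e₁ : A ≅ A')
    (e₂ : B ≅ B') (w : f ≫ e₂.hom = e₁.hom ≫ f') (h : IsQCatEquivalence f) :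
    IsQCatEquivalence f' := by
  obtain ⟨g, h₁, h₂⟩ := h
  have w' : f' = e₁.inv ≫ f ≫ e₂.hom := by rw [w, Iso.inv_hom_id_assoc]
  refine ⟨e₂.inv ≫ g ≫ e₁.hom, ?_, ?_⟩
  · simpa [w'] using h₁.whisker e₁.inv e₁.hom
  · simpa [w'] using h₂.whisker e₂.inv e₂.hom

/-! ### Homotopies and equivalences in a simplicially enriched category -/

section

variable {K : Type u} [Category.{v} K] [SimplicialCategory K]

lemma homEquiv'_comp {X A B : K} (h : X ⟶ A) (f : A ⟶ B) :
    (eHomWhiskerLeft SSet.{v} X f).app _ (homEquiv' X A h) = homEquiv' X B (h ≫ f) := by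
  have : eHomEquiv SSet.{v} h ≫ eHomWhiskerLeft SSet.{v} X f = eHomEquiv SSet.{v} (h ≫ f) := by
    rw [eHomEquiv_comp, eHomWhiskerLeft, rightUnitor_inv_naturality_assoc, ← unitors_inv_equal,
      tensorHom_def_assoc]
  exact congrArg (SSet.unitHomEquiv _) this

lemma homEquiv'_comp' {X A B : K} (h : X ⟶ A) (f : A ⟶ B) :
    (eHomWhiskerRight SSet.{v} h B).app _ (homEquiv' A B f) = homEquiv' X B (h ≫ f) := by
  have : eHomEquiv SSet.{v} f ≫ eHomWhiskerRight SSet.{v} h B = eHomEquiv SSet.{v} (h ≫ f) := by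
    rw [eHomEquiv_comp, eHomWhiskerRight, leftUnitor_inv_naturality_assoc, tensorHom_def'_assoc]
  exact congrArg (SSet.unitHomEquiv _) this

lemma lift_const_comp_sHomComp (X : K) {A B : K} (f : A ⟶ B) :
    CartesianMonoidalCategory.lift (𝟙 (sHom X A)) (SSet.const (homEquiv' A B f)) ≫
      sHomComp X A B = eHomWhiskerLeft SSet.{v} X f := by
  rw [eHomWhiskerLeft, ← Category.assoc]
  congr 1
  refine CartesianMonoidalCategory.hom_ext _ _ (by simp) ?_
  rw [CartesianMonoidalCategory.lift_snd]
  have h : SSet.const (homEquiv' A B f) = eHomEquiv SSet.{v} f :=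
    (SSet.unitHomEquiv _).symm_apply_apply _
  rw [← h, Category.assoc, CartesianMonoidalCategory.whiskerLeft_snd, ← Category.assoc,
    SSet.comp_const]

lemma isoHomotopic_eHomWhiskerLeft {A B : K} {f g : A ⟶ B}
    (h : IsoPath (homEquiv' A B f) (homEquiv' A B g)) (X : K) :
    IsoHomotopic (eHomWhiskerLeft SSet.{v} X f) (eHomWhiskerLeft SSet.{v} X g) := by
  obtain ⟨γ, h₀, h₁⟩ := h
  have (x : SSet.coherentIso.{v} _⦋0⦌) : atVertex (sHom X A) x ≫ sHom X A ◁ γ =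
      CartesianMonoidalCategory.lift (𝟙 _) (SSet.const (γ.app _ x)) :=
    CartesianMonoidalCategory.hom_ext _ _ (by simp [atVertex]) (by simp [atVertex])
  refine ⟨sHom X A ◁ γ ≫ sHomComp X A B, ?_, ?_⟩
  · rw [reassoc_of% this, h₀, lift_const_comp_sHomComp]
  · rw [reassoc_of% this, h₁, lift_const_comp_sHomComp]

/-- Equivalences out of an object `A` with `Fun(A, A)` a Kan complex are detected by two functor
spaces. -/
lemma isEquivalence_of_kanComplex {A B : K} (f : A ⟶ B) [SSet.KanComplex (sHom A A)]
    (hA : IsQCatEquivalence (eHomWhiskerLeft SSet.{v} A f))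
    (hB : IsQCatEquivalence (eHomWhiskerLeft SSet.{v} B f)) : IsEquivalence f := by
  obtain ⟨q, -, hq⟩ := hB
  obtain ⟨r, hr, -⟩ := hA
  -- As in the Yoneda lemma, the candidate inverse is the image of the identity of `B` under the
  -- inverse `q`.
  obtain ⟨g, hg⟩ := (homEquiv' B A).surjective (q.app _ (homEquiv' B B (𝟙 B)))
  have h₁ : IsoPath (homEquiv' B B (g ≫ f)) (homEquiv' B B (𝟙 B)) := by
    rw [← homEquiv'_comp, hg]
    exact hq.isoPath _
  have h₂ : IsoPath (homEquiv' A A (𝟙 A)) (homEquiv' A A (f ≫ g)) := by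
    -- The homotopy inverse `r` of postcomposition by `f` reflects paths: `𝟙 A` and `f ≫ g` are
    -- connected to `r f` and `r (f ≫ g ≫ f)`, and these are connected by `h₁`. Reversing and
    -- composing the paths uses that `Fun(A, A)` is a Kan complex.
    have h₃ (h : A ⟶ A) : IsoPath (homEquiv' A A h) (r.app _ (homEquiv' A B (h ≫ f))) := by
      rw [← homEquiv'_comp]
      exact hr.isoPath _
    have h₄ := (h₁.map (eHomWhiskerRight SSet.{v} f B)).map r
    rw [homEquiv'_comp', homEquiv'_comp', Category.comp_id] at h₄
    have h₅ := h₃ (𝟙 A)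
    have h₆ := h₃ (f ≫ g)
    rw [Category.id_comp] at h₅
    rw [Category.assoc] at h₆
    exact h₅.trans (h₆.trans h₄).symm
  intro X
  refine ⟨eHomWhiskerLeft SSet.{v} X g, ?_, ?_⟩
  · simpa using isoHomotopic_eHomWhiskerLeft h₂ X
  · simpa using isoHomotopic_eHomWhiskerLeft h₁ X

end

end InfCosmos

namespace InfCosmos

section

variable {K : Type u} [Category.{v} K] [SimplicialCategory K]

/-! ### Groupoidal objects -/

lemma isGroupoidalInBicategory_iff {C : Type*} [Category* C] [EnrichedOrdinaryCategory Cat C]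
    (E : CatEnrichedOrdinary C) :
    IsGroupoidalInBicategory E ↔ ∀ X : CatEnrichedOrdinary C, IsGroupoid (X.toBase ⟶ E.toBase) := by
  constructor
  · intro h X
    refine ⟨fun {a b} α ↦ ?_⟩
    obtain ⟨f, rfl⟩ := CatEnrichedOrdinary.homEquiv.surjective a
    obtain ⟨g, rfl⟩ := CatEnrichedOrdinary.homEquiv.surjective b
    obtain ⟨β, h₁, h₂⟩ := h X f g (CatEnrichedOrdinary.Hom.mk α)
    exact ⟨CatEnrichedOrdinary.Hom.base β, congrArg CatEnrichedOrdinary.Hom.base h₁,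
      congrArg CatEnrichedOrdinary.Hom.base h₂⟩
  · intro h X f g α
    have := h X
    obtain ⟨β, h₁, h₂⟩ := IsGroupoid.all_isIso (CatEnrichedOrdinary.Hom.base α)
    exact ⟨CatEnrichedOrdinary.Hom.mk β, CatEnrichedOrdinary.Hom.ext _ _ h₁,
      CatEnrichedOrdinary.Hom.ext _ _ h₂⟩

lemma isGroupoidal_iff_isGroupoid (E : K) :
    IsGroupoidal K E ↔ ∀ X : K, IsGroupoid (SSet.hoFunctor.obj (sHom X E)) :=
  isGroupoidalInBicategory_iff (C := TransportEnrichment SSet.hoFunctor.{v} K) E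

lemma eHomWhiskerLeft_whiskerRight_eComp (X : K) {P Q : K} (m : P ⟶ Q) (A : K) :
    eHomWhiskerLeft SSet.{v} X m ▷ _ ≫ sHomComp X Q A =
      sHom X P ◁ eHomWhiskerRight SSet.{v} m A ≫ sHomComp X P A := by
  simp only [eHomWhiskerLeft, eHomWhiskerRight, comp_whiskerRight, whiskerLeft_comp, assoc,
    ← e_assoc']
  simp

/-- The comparison is natural in the exponent. Through it `Fun(X, -)` turns `E ^ 𝕀 ⟶ E ^ 𝟚` into
restriction along `arrowToIso` for the simplicial set `Fun(X, E)`. -/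
lemma eHomWhiskerLeft_comp_cotensorComparison {U V : SSet.{v}} {A P Q : K} {η : V ⟶ sHom P A}
    {θ : U ⟶ sHom Q A} (i : U ⟶ V) (m : P ⟶ Q) (hm : θ ≫ eHomWhiskerRight SSet.{v} m A = i ≫ η)
    (X : K) : eHomWhiskerLeft SSet.{v} X m ≫ cotensorComparison θ X =
      cotensorComparison η X ≫ (MonoidalClosed.pre i).app (sHom X A) := by
  rw [cotensorComparison, cotensorComparison, MonoidalClosed.curry_pre_app,
    ← MonoidalClosed.curry_natural_left, BraidedCategory.braiding_naturality_right_assoc,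
    BraidedCategory.braiding_naturality_left_assoc, ← whisker_exchange_assoc,
    eHomWhiskerLeft_whiskerRight_eComp, ← whiskerLeft_comp_assoc, hm, whiskerLeft_comp_assoc]

lemma isTerminal_sHom {T : K} (hT : IsConicalLimit (asEmptyCone T)) (X : K) :
    Nonempty (IsTerminal (sHom X T)) := by
  obtain ⟨h⟩ := hT.isLimit_sHom X
  exact ⟨isLimitChangeEmptyCone _ h _ (Iso.refl _)⟩

lemma isCotensor_of_isTerminal {T : K} (hT : IsConicalLimit (asEmptyCone T)) {U : SSet.{v}}
    (η : U ⟶ sHom T T) : IsCotensor η := fun X ↦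
  isIso_of_isTerminal (isTerminal_sHom hT X).some
    (IsTerminal.isTerminalObj (ihom U) _ (isTerminal_sHom hT X).some) _

lemma isConicalLimit_pullbackCone_mk {P A B C : K} {h : P ⟶ A} {k : P ⟶ B} {f : A ⟶ C} {g : B ⟶ C}
    (w : h ≫ f = k ≫ g) (H : IsPullback h k f g)
    (H' : ∀ X : K, IsPullback (eHomWhiskerLeft SSet.{v} X h) (eHomWhiskerLeft SSet.{v} X k)
      (eHomWhiskerLeft SSet.{v} X f) (eHomWhiskerLeft SSet.{v} X g)) :
    IsConicalLimit (PullbackCone.mk h k w) where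
  isLimit := ⟨H.isLimit⟩
  isLimit_sHom X := ⟨(isLimitMapConePullbackConeEquiv (eCoyoneda SSet.{v} X) w).symm
    (H' X).isLimit⟩

end

/-! ### The equivalent conditions for a groupoidal object -/

namespace IsInfinityCosmos

variable {K : Type u} [Category.{v} K] [SimplicialCategory K] {isofib : MorphismProperty K}

/-- An inclusion of simplicial sets induces an isofibration between cotensors. -/
lemma isofib_cotensorMap (hK : IsInfinityCosmos K isofib) {E EV EU : K} {U V : SSet.{v}}
    {η : V ⟶ sHom EV E} {θ : U ⟶ sHom EU E} (hη : IsCotensor η) (hθ : IsCotensor θ) (i : U ⟶ V)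
    [Mono i] : isofib (hη.map hθ i (𝟙 E)) := by
  obtain ⟨T, hT⟩ := hK.exists_terminal
  obtain ⟨t⟩ := hT.isLimit
  replace t : IsTerminal T := t
  let ζ (W : SSet.{v}) : W ⟶ sHom T T := (isTerminal_sHom hT T).some.from W
  have hζ (W : SSet.{v}) : IsCotensor (ζ W) := isCotensor_of_isTerminal hT _
  let p : E ⟶ T := t.from E
  have : IsIso ((hζ V).map (hζ U) i (𝟙 T)) := isIso_of_isTerminal t t _
  have w : t.from EU ≫ (hζ V).map (hζ U) i (𝟙 T) = 𝟙 EU ≫ hθ.map (hζ U) (𝟙 U) p := t.hom_ext _ _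
  -- This is the Leibniz axiom for `E ⟶ 1`: the cotensors of `1` are again `1`, so the pullback is
  -- `E ^ U`.
  refine hK.isofib_leibniz p (hK.isofib_to_terminal hT p) i hη hθ (hζ V) (hζ U)
    (PullbackCone.mk (t.from EU) (𝟙 EU) w) ?_ (hη.map hθ i (𝟙 E)) (t.hom_ext _ _) (comp_id _)
  refine isConicalLimit_pullbackCone_mk w (IsPullback.of_vert_isIso ⟨w⟩) fun X ↦ ?_
  have h₁ : IsIso (eHomWhiskerLeft SSet.{v} X (𝟙 EU)) := by
    rw [eHomWhiskerLeft_id]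
    infer_instance
  have h₂ : IsIso (eHomWhiskerLeft SSet.{v} X ((hζ V).map (hζ U) i (𝟙 T))) :=
    isIso_of_isTerminal (isTerminal_sHom hT X).some (isTerminal_sHom hT X).some _
  exact IsPullback.of_vert_isIso ⟨by rw [← eHomWhiskerLeft_comp, w, eHomWhiskerLeft_comp]⟩

lemma eHomWhiskerLeft_cotensorMap {E EV EU : K} {U V : SSet.{v}}
    {η : V ⟶ sHom EV E} {θ : U ⟶ sHom EU E} (hη : IsCotensor η) (hθ : IsCotensor θ) (i : U ⟶ V)
    (X : K) : eHomWhiskerLeft SSet.{v} X (hη.map hθ i (𝟙 E)) ≫ cotensorComparison θ X =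
      cotensorComparison η X ≫ (MonoidalClosed.pre i).app (sHom X E) :=
  eHomWhiskerLeft_comp_cotensorComparison _ _ (by
    rw [IsCotensor.map, IsCotensor.lift_spec, eHomWhiskerLeft_id, comp_id]) X

lemma isTrivialFibration_cotensorMap (hK : IsInfinityCosmos K isofib) {E EI E2 : K}
    (hE : ∀ X : K, SSet.KanComplex (sHom X E)) {η : SSet.coherentIso.{v} ⟶ sHom EI E}
    {θ : Δ[1] ⟶ sHom E2 E} (hη : IsCotensor η) (hθ : IsCotensor θ) :
    IsTrivialFibration isofib (hη.map hθ arrowToIso (𝟙 E)) := by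
  refine ⟨hK.isofib_cotensorMap hη hθ _, fun X ↦ ?_⟩
  have := hE X
  have := hη X
  have := hθ X
  refine (isQCatEquivalence_of_rlp
    (rlp_pre_app (Q := sHom X E) anodyneExtensions_arrowToIso)).of_iso
      (asIso (cotensorComparison η X)).symm (asIso (cotensorComparison θ X)).symm ?_
  simp only [Iso.symm_hom, asIso_inv, IsIso.eq_inv_comp]
  rw [← assoc, ← eHomWhiskerLeft_cotensorMap hη hθ, assoc, IsIso.hom_inv_id, comp_id]

lemma isGroupoid_of_isTrivialFibration (hK : IsInfinityCosmos K isofib) {E EI E2 : K}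
    {η : SSet.coherentIso.{v} ⟶ sHom EI E} {θ : Δ[1] ⟶ sHom E2 E} (hη : IsCotensor η)
    (hθ : IsCotensor θ) (h : IsTrivialFibration isofib (hη.map hθ arrowToIso (𝟙 E))) (X : K) :
    IsGroupoid (SSet.hoFunctor.obj (sHom X E)) := by
  have := hη X
  have := hθ X
  have w := eHomWhiskerLeft_cotensorMap hη hθ arrowToIso X
  have e : Arrow.mk (eHomWhiskerLeft SSet.{v} X (hη.map hθ arrowToIso (𝟙 E))) ≅
      Arrow.mk ((MonoidalClosed.pre arrowToIso).app (sHom X E)) :=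
    Arrow.isoMk' _ _ (asIso (cotensorComparison η X)) (asIso (cotensorComparison θ X)) w.symm
  obtain ⟨h₁, h₂, h₃⟩ := hK.isofib_sHom X _ h.1
  exact isGroupoid_of_isQCatEquivalence
    ⟨(SSet.innerFibrations.arrow_mk_iso_iff e).1 h₁,
      (HasLiftingProperty.iff_of_arrow_iso_right _ e).1 h₂,
      (HasLiftingProperty.iff_of_arrow_iso_right _ e).1 h₃⟩
    ((h.2 X).of_iso (asIso (cotensorComparison η X)) (asIso (cotensorComparison θ X)) w)

lemma isGroupoidal_iff_kanComplex (hK : IsInfinityCosmos K isofib) (E : K) :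
    IsGroupoidal K E ↔ ∀ X : K, SSet.KanComplex (sHom X E) := by
  rw [isGroupoidal_iff_isGroupoid]
  refine forall_congr' fun X ↦ ?_
  have := hK.quasicategory X E
  exact isGroupoid_hoFunctor_iff_kanComplex _

lemma isGroupoidal_tfae (hK : IsInfinityCosmos K isofib) (E : K) : List.TFAE [
    IsGroupoidal K E,
    ∀ X : K, IsGroupoid (SSet.hoFunctor.obj (sHom X E)),
    ∀ X : K, SSet.KanComplex (sHom X E),
    ∀ (EI E2 : K) (η : SSet.coherentIso.{v} ⟶ sHom EI E) (θ : Δ[1] ⟶ sHom E2 E)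
      (hη : IsCotensor η) (hθ : IsCotensor θ),
      IsTrivialFibration isofib (hη.map hθ arrowToIso (𝟙 E))] := by
  tfae_have 1 ↔ 2 := isGroupoidal_iff_isGroupoid E
  tfae_have 1 ↔ 3 := hK.isGroupoidal_iff_kanComplex E
  tfae_have 3 → 4 := fun h _ _ _ _ hη hθ ↦ hK.isTrivialFibration_cotensorMap h hη hθ
  tfae_have 4 → 2 := fun h X ↦ by
    obtain ⟨EI, η, hη⟩ := hK.exists_cotensor E SSet.coherentIso
    obtain ⟨E2, θ, hθ⟩ := hK.exists_cotensor E Δ[1]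
    exact hK.isGroupoid_of_isTrivialFibration hη hθ (h EI E2 η θ hη hθ) X
  tfae_finish

end IsInfinityCosmos

end InfCosmos

namespace InfCosmos

open HomotopicalAlgebra SSet.modelCategoryQuillen

/-! ### Limits of Kan complexes -/

lemma kanComplex_iff_exists_extension (Q : SSet.{u}) : SSet.KanComplex Q ↔
    ∀ ⦃A B : SSet.{u}⦄ (i : A ⟶ B), SSet.anodyneExtensions i → ∀ f : A ⟶ Q, ∃ g, i ≫ g = f := by
  refine ⟨fun _ A B i hi f ↦ exists_extension_of_anodyne hi f, fun h ↦ (isFibrant_iff _).2 ?_⟩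
  rw [SSet.modelCategoryQuillen.fibration_iff]
  intro A B i hi
  refine ⟨fun {f g} sq ↦ ?_⟩
  obtain ⟨l, hl⟩ := h i (fun E B p hp ↦ hp _ hi) f
  exact ⟨⟨⟨l, hl, terminal.hom_ext _ _⟩⟩⟩

lemma kanComplex_of_iso {P Q : SSet.{u}} (e : P ≅ Q) [SSet.KanComplex P] : SSet.KanComplex Q := by
  rw [kanComplex_iff_exists_extension]
  intro A B i hi f
  obtain ⟨g, hg⟩ := exists_extension_of_anodyne hi (f ≫ e.inv)
  exact ⟨g ≫ e.hom, by simp [reassoc_of% hg]⟩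

lemma exists_lift_of_anodyne {A B P Q : SSet.{u}} {i : A ⟶ B} (hi : SSet.anodyneExtensions i)
    {p : P ⟶ Q} (hp : Fibration p) (f : A ⟶ P) (g : B ⟶ Q) (w : f ≫ p = i ≫ g) :
    ∃ l : B ⟶ P, i ≫ l = f ∧ l ≫ p = g := by
  have := hi p (by rwa [← HomotopicalAlgebra.fibration_iff])
  have sq : CommSq f i p g := ⟨w⟩
  exact ⟨sq.lift, sq.fac_left, sq.fac_right⟩

lemma kanComplex_of_isLimit_discrete {J : Type*} {D : Discrete J ⥤ SSet.{u}} {c : Cone D}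
    (hc : IsLimit c) (h : ∀ j, SSet.KanComplex (D.obj j)) : SSet.KanComplex c.pt := by
  rw [kanComplex_iff_exists_extension]
  intro A B i hi f
  choose g hg using fun j ↦ have := h j; exists_extension_of_anodyne hi (f ≫ c.π.app j)
  exact ⟨hc.lift ⟨B, Discrete.natTrans g⟩, hc.hom_ext fun j ↦ by simp [hg]⟩

/-- Extend the component in the left corner first, then lift its image through the Kan fibration on
the right. -/
lemma kanComplex_of_isLimit_cospan {D : WalkingCospan ⥤ SSet.{u}} {c : Cone D} (hc : IsLimit c)
    (h : SSet.KanComplex (D.obj .left)) (hp : Fibration (D.map WalkingCospan.Hom.inr)) :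
    SSet.KanComplex c.pt := by
  rw [kanComplex_iff_exists_extension]
  intro A B i hi f
  obtain ⟨g, hg⟩ := exists_extension_of_anodyne hi (f ≫ c.π.app .left)
  obtain ⟨l, hl, hl'⟩ := exists_lift_of_anodyne hi hp (f ≫ c.π.app .right)
    (g ≫ D.map WalkingCospan.Hom.inl) (by rw [reassoc_of% hg]; simp)
  let s : Cone D := Cone.ofPullbackCone (PullbackCone.mk g l hl'.symm)
  refine ⟨hc.lift s, hc.hom_ext fun j ↦ ?_⟩
  have h₁ : i ≫ s.π.app .left = f ≫ c.π.app .left := (congrArg (i ≫ ·) (comp_id g)).trans hg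
  have h₂ : i ≫ s.π.app .right = f ≫ c.π.app .right := (congrArg (i ≫ ·) (comp_id l)).trans hl
  refine (assoc _ _ _).trans ((congrArg (i ≫ ·) (hc.fac s j)).trans ?_)
  rcases j with _ | _ | _
  · refine (congrArg (i ≫ ·) (s.w WalkingCospan.Hom.inl).symm).trans ((assoc _ _ _).symm.trans ?_)
    refine (congrArg (· ≫ _) h₁).trans ((assoc _ _ _).trans ?_)
    exact congrArg (f ≫ ·) (c.w WalkingCospan.Hom.inl)
  · exact h₁
  · exact h₂

/-- Extend at the bottom stage and lift through one Kan fibration at a time; the recursive choices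
form a cone. -/
lemma kanComplex_of_isLimit_tower {D : ℕᵒᵖ ⥤ SSet.{u}} {c : Cone D} (hc : IsLimit c)
    (h : SSet.KanComplex (D.obj (op 0)))
    (hp : ∀ n : ℕ, Fibration (D.map (homOfLE n.le_succ).op)) : SSet.KanComplex c.pt := by
  rw [kanComplex_iff_exists_extension]
  intro A B i hi f
  have h₀ := exists_extension_of_anodyne hi (f ≫ c.π.app (op 0))
  have h₁ (n : ℕ) (g : { g : B ⟶ D.obj (op n) // i ≫ g = f ≫ c.π.app (op n) }) :
      ∃ l : B ⟶ D.obj (op (n + 1)), i ≫ l = f ≫ c.π.app (op (n + 1)) ∧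
        l ≫ D.map (homOfLE n.le_succ).op = g.1 :=
    exists_lift_of_anodyne hi (hp n) _ _ (by rw [assoc, c.w, g.2])
  choose l hl hl' using h₁
  let g (n : ℕ) : { g : B ⟶ D.obj (op n) // i ≫ g = f ≫ c.π.app (op n) } :=
    Nat.rec ⟨h₀.choose, h₀.choose_spec⟩ (fun n g ↦ ⟨l n g, hl n g⟩) n
  let s : Cone D := ⟨B, NatTrans.ofOpSequence (fun n ↦ (g n).1) fun n ↦ by
    simpa using (hl' n (g n)).symm⟩
  exact ⟨hc.lift s, hc.hom_ext fun j ↦ by simpa [s] using (g j.unop).2⟩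

end InfCosmos

namespace InfCosmos

section

variable {K : Type u} [Category.{v} K] [SimplicialCategory K]

/-! ### Conical limits and cotensors in full subcategories -/

lemma IsConicalLimit.of_iso {J : Type*} [Category* J] {D : J ⥤ K} {c c' : Cone D}
    (h : IsConicalLimit c) (e : c ≅ c') : IsConicalLimit c' where
  isLimit := ⟨h.isLimit.some.ofIsoLimit e⟩
  isLimit_sHom X := ⟨(h.isLimit_sHom X).some.ofIsoLimit
    ((Cone.functoriality D (eCoyoneda SSet.{v} X)).mapIso e)⟩

lemma IsConicalLimit.postcompose {J : Type*} [Category* J] {D D' : J ⥤ K} {c : Cone D}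
    (h : IsConicalLimit c) (α : D ≅ D') : IsConicalLimit ((Cone.postcompose α.hom).obj c) where
  isLimit := ⟨(IsLimit.postcomposeHomEquiv α c).symm h.isLimit.some⟩
  isLimit_sHom X := ⟨((IsLimit.postcomposeHomEquiv
    (Functor.isoWhiskerRight α (eCoyoneda SSet.{v} X)) _).symm
      (h.isLimit_sHom X).some).ofIsoLimit (Cone.ext (Iso.refl _))⟩

variable {P : ObjectProperty K}

lemma IsConicalLimit.of_mapCone {J : Type*} [Category* J] {D : J ⥤ P.FullSubcategory} {c : Cone D}
    (h : IsConicalLimit (P.ι.mapCone c)) : IsConicalLimit c where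
  isLimit := ⟨isLimitOfReflects P.ι h.isLimit.some⟩
  isLimit_sHom X := h.isLimit_sHom X.obj

/-- The lift to a full subcategory of a cone whose point satisfies the property. -/
def liftCone {J : Type*} [Category* J] {D : J ⥤ P.FullSubcategory} (c : Cone (D ⋙ P.ι))
    (hc : P c.pt) : Cone D where
  pt := ⟨c.pt, hc⟩
  π :=
    { app j := P.homMk (c.π.app j)
      naturality _ _ f := P.ι.map_injective (c.π.naturality f) }

lemma exists_isConicalLimit {J : Type*} [Category* J] {D : J ⥤ P.FullSubcategory}
    (h₁ : ∀ c : Cone (D ⋙ P.ι), IsConicalLimit c → P c.pt)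
    (h₂ : ∃ c : Cone (D ⋙ P.ι), IsConicalLimit c) :
    ∃ c : Cone D, IsConicalLimit (P.ι.mapCone c) := by
  obtain ⟨c, hc⟩ := h₂
  exact ⟨liftCone c (h₁ c hc), hc⟩

/-- A limit in `K` lies in `P` by `h₁` and is then a limit in the full subcategory too. Any limit
cone there is isomorphic to it, hence is a limit cone in `K`, even though `K` has more test objects.
-/
lemma createsConicalLimit {J : Type*} [Category* J] {D : J ⥤ P.FullSubcategory}
    (h₁ : ∀ c : Cone (D ⋙ P.ι), IsConicalLimit c → P c.pt)
    (h₂ : ∃ c : Cone (D ⋙ P.ι), IsConicalLimit c) : CreatesConicalLimit P D := by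
  refine ⟨h₁, fun c ↦ ⟨fun hc ↦ ?_, .of_mapCone⟩⟩
  obtain ⟨c', hc'⟩ := exists_isConicalLimit h₁ h₂
  exact hc'.of_iso ((Cone.functoriality D P.ι).mapIso
    ((IsConicalLimit.of_mapCone hc').isLimit.some.uniqueUpToIso hc.isLimit.some))

lemma IsCotensor.of_iso {U : SSet.{v}} {A Q Q' : K} {η : U ⟶ sHom Q A} {η' : U ⟶ sHom Q' A}
    (h : IsCotensor η) (e : Q' ≅ Q) (he : η ≫ eHomWhiskerRight SSet.{v} e.hom A = η') :
    IsCotensor η' := fun X ↦ by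
  have := h X
  have h₁ := eHomWhiskerLeft_comp_cotensorComparison (η := η') (θ := η) (𝟙 U) e.hom
    (by rw [he, id_comp]) X
  rw [MonoidalClosed.pre_id] at h₁
  have : IsIso (eHomWhiskerLeft SSet.{v} X e.hom) :=
    ((eCoyoneda SSet.{v} X).mapIso e).isIso_hom
  have h₂ : cotensorComparison η' X = eHomWhiskerLeft SSet.{v} X e.hom ≫ cotensorComparison η X :=
    (h₁.trans (comp_id _)).symm
  rw [h₂]
  infer_instance

lemma IsCotensor.exists_iso {U : SSet.{v}} {A Q Q' : K} {η : U ⟶ sHom Q A} {η' : U ⟶ sHom Q' A}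
    (h : IsCotensor η) (h' : IsCotensor η') :
    ∃ e : Q' ≅ Q, η ≫ eHomWhiskerRight SSet.{v} e.hom A = η' :=
  ⟨{ hom := h.lift η'
     inv := h'.lift η
     hom_inv_id := (h'.eq_lift η' _ (by simp [reassoc_of% h'.lift_spec, h.lift_spec])).trans
      (h'.eq_lift η' _ (by simp)).symm
     inv_hom_id := (h.eq_lift η _ (by simp [reassoc_of% h.lift_spec, h'.lift_spec])).trans
      (h.eq_lift η _ (by simp)).symm }, h.lift_spec _⟩

lemma createsCotensor {A : P.FullSubcategory} {U : SSet.{v}}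
    (h₁ : ∀ (Q : K) (η : U ⟶ sHom Q A.obj), IsCotensor η → P Q)
    (h₂ : ∃ (Q : K) (η : U ⟶ sHom Q A.obj), IsCotensor η) : CreatesCotensor P A U := by
  refine ⟨h₁, fun Q η ↦ ⟨fun h ↦ ?_, fun h X ↦ h X.obj⟩⟩
  obtain ⟨Q', η', hη'⟩ := h₂
  have h' : IsCotensor (K := P.FullSubcategory) (A := A) (P := ⟨Q', h₁ Q' η' hη'⟩) η' :=
    fun X ↦ hη' X.obj
  obtain ⟨e, he⟩ := h'.exists_iso h
  exact hη'.of_iso (P.ι.mapIso e) he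

lemma ι_map_cotensorMap {U V : SSet.{v}} {A B Q R : P.FullSubcategory} {η : V ⟶ sHom Q A}
    {θ : U ⟶ sHom R B} (hη : IsCotensor η) (hθ : IsCotensor θ)
    (hη' : IsCotensor (A := A.obj) (P := Q.obj) η) (hθ' : IsCotensor (A := B.obj) (P := R.obj) θ)
    (i : U ⟶ V) (f : A ⟶ B) :
    P.ι.map (hη.map hθ i f) = hη'.map hθ' i (P.ι.map f) :=
  hθ'.eq_lift _ _ (hθ.lift_spec (i ≫ η ≫ eHomWhiskerLeft SSet.{v} Q f))

end

end InfCosmos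

namespace InfCosmos

namespace IsInfinityCosmos

open HomotopicalAlgebra SSet.modelCategoryQuillen

variable {K : Type u} [Category.{v} K] [SimplicialCategory K] {isofib : MorphismProperty K}

/-! ### The ∞-cosmos of groupoidal objects -/

lemma kanComplex_sHom (hK : IsInfinityCosmos K isofib) (X : K) (E : GroupoidalObjects K) :
    SSet.KanComplex (sHom X E.obj) :=
  (hK.isGroupoidal_iff_kanComplex E.obj).1 E.property X

lemma fibration_eHomWhiskerLeft (hK : IsInfinityCosmos K isofib) (X : K) {E B : K}
    (hE : IsGroupoidal K E) (hB : IsGroupoidal K B) {p : E ⟶ B} (hp : isofib p) :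
    Fibration (eHomWhiskerLeft SSet.{v} X p) := by
  have := hK.kanComplex_sHom X ⟨E, hE⟩
  have := hK.kanComplex_sHom X ⟨B, hB⟩
  exact fibration_of_isQCatIsofibration (hK.isofib_sHom X p hp)

lemma isGroupoidal_discreteLimit (hK : IsInfinityCosmos K isofib) {J : Type*}
    {D : Discrete J ⥤ GroupoidalObjects K} {c : Cone (D ⋙ (IsGroupoidal K).ι)}
    (hc : IsConicalLimit c) : IsGroupoidal K c.pt :=
  (hK.isGroupoidal_iff_kanComplex _).2 fun X ↦
    kanComplex_of_isLimit_discrete (hc.isLimit_sHom X).some fun j ↦ hK.kanComplex_sHom X (D.obj j)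

lemma isGroupoidal_towerLimit (hK : IsInfinityCosmos K isofib)
    {D : ℕᵒᵖ ⥤ GroupoidalObjects K} (hD : IsTower isofib (D ⋙ (IsGroupoidal K).ι))
    {c : Cone (D ⋙ (IsGroupoidal K).ι)} (hc : IsConicalLimit c) : IsGroupoidal K c.pt :=
  (hK.isGroupoidal_iff_kanComplex _).2 fun X ↦
    kanComplex_of_isLimit_tower (hc.isLimit_sHom X).some (hK.kanComplex_sHom X (D.obj _)) fun n ↦
      hK.fibration_eHomWhiskerLeft X (D.obj _).property (D.obj _).property (hD n)

lemma isGroupoidal_pullback (hK : IsInfinityCosmos K isofib) {A B E : GroupoidalObjects K}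
    {f : A ⟶ B} {p : E ⟶ B} (hp : isofib ((IsGroupoidal K).ι.map p))
    {c : Cone (cospan f p ⋙ (IsGroupoidal K).ι)} (hc : IsConicalLimit c) : IsGroupoidal K c.pt :=
  (hK.isGroupoidal_iff_kanComplex _).2 fun X ↦
    kanComplex_of_isLimit_cospan (hc.isLimit_sHom X).some (hK.kanComplex_sHom X A)
      (hK.fibration_eHomWhiskerLeft X E.property B.property hp)

lemma isGroupoidal_cotensor (hK : IsInfinityCosmos K isofib) {A : GroupoidalObjects K}
    {U : SSet.{v}} {Q : K} {η : U ⟶ sHom Q A.obj} (hη : IsCotensor η) : IsGroupoidal K Q :=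
  (hK.isGroupoidal_iff_kanComplex _).2 fun X ↦ by
    have := hK.kanComplex_sHom X A
    have := hη X
    exact kanComplex_of_iso (asIso (cotensorComparison η X)).symm

lemma exists_emptyLimit (hK : IsInfinityCosmos K isofib) (D : Discrete PEmpty.{1} ⥤ K) :
    ∃ c : Cone D, IsConicalLimit c := by
  obtain ⟨T, hT⟩ := hK.exists_terminal
  exact ⟨_, hT.postcompose (Functor.emptyExt _ _)⟩

lemma exists_discreteLimit (hK : IsInfinityCosmos K isofib) {I : Type v} (D : Discrete I ⥤ K) :
    ∃ c : Cone D, IsConicalLimit c := by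
  obtain ⟨c, hc⟩ := hK.exists_product (D.obj ⟨·⟩)
  exact ⟨_, hc.postcompose Discrete.natIsoFunctor.symm⟩

lemma exists_cospanLimit (hK : IsInfinityCosmos K isofib) {A B E : GroupoidalObjects K}
    (f : A ⟶ B) (p : E ⟶ B) (hp : isofib ((IsGroupoidal K).ι.map p)) :
    ∃ c : Cone (cospan f p ⋙ (IsGroupoidal K).ι), IsConicalLimit c := by
  obtain ⟨c, hc⟩ := hK.exists_pullback ((IsGroupoidal K).ι.map f) _ hp
  exact ⟨_, hc.postcompose (cospanCompIso _ f p).symm⟩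

lemma createsCosmologicalLimits (hK : IsInfinityCosmos K isofib) :
    CreatesCosmologicalLimits (IsGroupoidal K) isofib where
  terminal _ := createsConicalLimit (fun _ ↦ hK.isGroupoidal_discreteLimit)
    (hK.exists_emptyLimit _)
  product _ := createsConicalLimit (fun _ ↦ hK.isGroupoidal_discreteLimit)
    (hK.exists_discreteLimit _)
  cotensor A U := createsCotensor (fun _ _ ↦ hK.isGroupoidal_cotensor) (hK.exists_cotensor A.obj U)
  towerLimit _ hD := createsConicalLimit (fun _ ↦ hK.isGroupoidal_towerLimit hD)
    (hK.exists_towerLimit _ hD)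
  pullback f p hp := createsConicalLimit (fun _ ↦ hK.isGroupoidal_pullback hp)
    (hK.exists_cospanLimit f p hp)

/-- For the nontrivial direction only the test objects `A` and `B` are needed, and both are
groupoidal. -/
lemma isEquivalence_iff (hK : IsInfinityCosmos K isofib) {A B : GroupoidalObjects K} (f : A ⟶ B) :
    IsEquivalence f ↔ IsEquivalence ((IsGroupoidal K).ι.map f) := by
  refine ⟨fun h ↦ ?_, fun h X ↦ h X.obj⟩
  have : SSet.KanComplex (sHom ((IsGroupoidal K).ι.obj A) ((IsGroupoidal K).ι.obj A)) :=
    hK.kanComplex_sHom A.obj A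
  exact isEquivalence_of_kanComplex _ (h A) (h B)

lemma isConicalLimit_ι_terminal (hK : IsInfinityCosmos K isofib) {T : GroupoidalObjects K}
    (hT : IsConicalLimit (asEmptyCone T)) : IsConicalLimit (asEmptyCone T.obj) :=
  (((hK.createsCosmologicalLimits.terminal _).2 _).1 hT).postcompose (Functor.emptyExt _ _)
    |>.of_iso (Cone.ext (Iso.refl _) (by rintro ⟨⟨⟩⟩))

/-- The image in `K` of a pullback square of groupoidal objects. -/
abbrev ιPullbackCone {A B E : GroupoidalObjects K} {f : A ⟶ B} {p : E ⟶ B}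
    (c : PullbackCone f p) :
    PullbackCone ((IsGroupoidal K).ι.map f) ((IsGroupoidal K).ι.map p) :=
  PullbackCone.mk ((IsGroupoidal K).ι.map c.fst) ((IsGroupoidal K).ι.map c.snd)
    (by rw [← Functor.map_comp, c.condition, Functor.map_comp])

lemma isConicalLimit_ιPullbackCone (hK : IsInfinityCosmos K isofib) {A B E : GroupoidalObjects K}
    {f : A ⟶ B} {p : E ⟶ B} {c : PullbackCone f p} (hc : IsConicalLimit c)
    (hp : isofib ((IsGroupoidal K).ι.map p)) : IsConicalLimit (ιPullbackCone c) :=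
  (((hK.createsCosmologicalLimits.pullback f p hp).2 _).1 hc).postcompose (cospanCompIso _ f p)
    |>.of_iso (PullbackCone.ext (Iso.refl _) ((comp_id _).trans (id_comp _).symm)
      ((comp_id _).trans (id_comp _).symm))

lemma isCotensor_initial {T : K} (hT : IsConicalLimit (asEmptyCone T)) {A : K}
    (η : ⊥_ SSet.{v} ⟶ sHom T A) : IsCotensor η := fun X ↦
  isIso_of_isTerminal (isTerminal_sHom hT X).some
    (IsTerminal.isTerminalObj (MonoidalClosed.internalHom.flip.obj (sHom X A)) _
      initialIsInitial.op) _

/-- Cotensors of isofibrations are isofibrations. -/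
lemma isofib_cotensorMap_left (hK : IsInfinityCosmos K isofib) {E B EU BU : K} {U : SSet.{v}}
    {η : U ⟶ sHom EU E} {θ : U ⟶ sHom BU B} (hη : IsCotensor η) (hθ : IsCotensor θ)
    {p : E ⟶ B} (hp : isofib p) : isofib (hη.map hθ (𝟙 U) p) := by
  obtain ⟨T, hT⟩ := hK.exists_terminal
  obtain ⟨t⟩ := hT.isLimit
  replace t : IsTerminal T := t
  have hζ (A : K) : IsCotensor (initial.to (sHom T A)) := isCotensor_initial hT _
  have : IsIso ((hζ E).map (hζ B) (𝟙 _) p) := isIso_of_isTerminal t t _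
  have w : 𝟙 BU ≫ hθ.map (hζ B) (initial.to U) (𝟙 B) = t.from BU ≫ (hζ E).map (hζ B) (𝟙 _) p :=
    t.hom_ext _ _
  -- This is the Leibniz axiom for `∅ ⟶ U`: cotensors by `∅` are terminal, so the pullback is `B ^
  -- U`.
  refine hK.isofib_leibniz p hp (initial.to U) hη (hζ E) hθ (hζ B)
    (PullbackCone.mk (𝟙 BU) (t.from BU) w) ?_ (hη.map hθ (𝟙 U) p) (comp_id _) (t.hom_ext _ _)
  refine isConicalLimit_pullbackCone_mk w (IsPullback.of_horiz_isIso ⟨w⟩) fun X ↦ ?_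
  have h₁ : IsIso (eHomWhiskerLeft SSet.{v} X (𝟙 BU)) := by
    rw [eHomWhiskerLeft_id]
    infer_instance
  have h₂ : IsIso (eHomWhiskerLeft SSet.{v} X ((hζ E).map (hζ B) (𝟙 _) p)) :=
    isIso_of_isTerminal (isTerminal_sHom hT X).some (isTerminal_sHom hT X).some _
  exact IsPullback.of_horiz_isIso ⟨by rw [← eHomWhiskerLeft_comp, w, eHomWhiskerLeft_comp]⟩

/-- The legs of a cospan coming from the full subcategory are only provably equal to the cotensor
maps formed in `K`, hence the variables `f` and `g`. -/
lemma isofib_leibniz_of_eq (hK : IsInfinityCosmos K isofib) {E B : K} {p : E ⟶ B} (hp : isofib p)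
    {U V : SSet.{v}} (i : U ⟶ V) [Mono i] {EV EU BV BU : K}
    {ηEV : V ⟶ sHom EV E} {ηEU : U ⟶ sHom EU E} {ηBV : V ⟶ sHom BV B} {ηBU : U ⟶ sHom BU B}
    (hEV : IsCotensor ηEV) (hEU : IsCotensor ηEU) (hBV : IsCotensor ηBV) (hBU : IsCotensor ηBU)
    {f : BV ⟶ BU} (hf : f = hBV.map hBU i (𝟙 B)) {g : EU ⟶ BU} (hg : g = hEU.map hBU (𝟙 U) p)
    (c : PullbackCone f g) (hc : IsConicalLimit c)
    (m : EV ⟶ c.pt) (h₁ : m ≫ c.fst = hEV.map hBV (𝟙 V) p)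
    (h₂ : m ≫ c.snd = hEV.map hEU i (𝟙 E)) : isofib m := by
  subst hf hg
  exact hK.isofib_leibniz p hp i hEV hEU hBV hBU c hc m h₁ h₂

lemma isInfinityCosmos_groupoidalObjects (hK : IsInfinityCosmos K isofib) :
    IsInfinityCosmos (GroupoidalObjects K) (isofib.inverseImage (IsGroupoidal K).ι) where
  quasicategory A B := hK.quasicategory A.obj B.obj
  isMultiplicative := by
    have := hK.isMultiplicative
    infer_instance
  exists_terminal := by
    obtain ⟨c, hc⟩ := exists_isConicalLimit (D := Functor.empty (GroupoidalObjects K))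
      (fun _ ↦ hK.isGroupoidal_discreteLimit) (hK.exists_emptyLimit _)
    exact ⟨c.pt, hc.of_mapCone.of_iso (Cone.ext (Iso.refl _) (by rintro ⟨⟨⟩⟩))⟩
  exists_product A := by
    obtain ⟨c, hc⟩ := exists_isConicalLimit (D := Discrete.functor A)
      (fun _ ↦ hK.isGroupoidal_discreteLimit) (hK.exists_discreteLimit _)
    exact ⟨c, hc.of_mapCone⟩
  exists_cotensor A U := by
    obtain ⟨Q, η, hη⟩ := hK.exists_cotensor A.obj U
    exact ⟨⟨Q, hK.isGroupoidal_cotensor hη⟩, η, fun X ↦ hη X.obj⟩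
  exists_towerLimit D hD := by
    obtain ⟨c, hc⟩ := exists_isConicalLimit (fun _ ↦ hK.isGroupoidal_towerLimit hD)
      (hK.exists_towerLimit _ hD)
    exact ⟨c, hc.of_mapCone⟩
  exists_pullback f p hp := by
    obtain ⟨c, hc⟩ := exists_isConicalLimit (fun _ ↦ hK.isGroupoidal_pullback hp)
      (hK.exists_cospanLimit f p hp)
    exact ⟨c, hc.of_mapCone⟩
  isofib_of_isIso f _ := hK.isofib_of_isIso ((IsGroupoidal K).ι.map f)
  isofib_to_terminal hT f := hK.isofib_to_terminal (hK.isConicalLimit_ι_terminal hT) _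
  isofib_pullback c hc hp :=
    hK.isofib_pullback (ιPullbackCone c) (hK.isConicalLimit_ιPullbackCone hc hp) hp
  isofib_towerLimit hD c hc n := hK.isofib_towerLimit (D := _ ⋙ (IsGroupoidal K).ι) hD _
    (((hK.createsCosmologicalLimits.towerLimit _ hD).2 c).1 hc) n
  isofib_leibniz p hp U V i _ EV EU BV BU ηEV ηEU ηBV ηBU hEV hEU hBV hBU c hc m h₁ h₂ := by
    have creates {A Q : GroupoidalObjects K} {W : SSet.{v}} {η : W ⟶ sHom Q A}
        (h : IsCotensor η) : IsCotensor (A := A.obj) (P := Q.obj) η :=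
      ((hK.createsCosmologicalLimits.cotensor A W).2 Q η).1 h
    have hEU' := creates hEU
    have hBU' := creates hBU
    have hg := ι_map_cotensorMap hEU hBU hEU' hBU' (𝟙 U) p
    refine hK.isofib_leibniz_of_eq hp i (creates hEV) hEU' (creates hBV) hBU'
      (ι_map_cotensorMap hBV hBU (creates hBV) hBU' i (𝟙 _)) hg (ιPullbackCone c)
      (hK.isConicalLimit_ιPullbackCone hc ?_) ((IsGroupoidal K).ι.map m) ?_ ?_
    -- The pullback is preserved by the inclusion only if the leg `E ^ U ⟶ B ^ U` is an
    -- isofibration, which the Leibniz axiom for `∅ ⟶ U` provides.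
    · rw [hg]
      exact hK.isofib_cotensorMap_left hEU' hBU' hp
    · exact (congrArg (IsGroupoidal K).ι.map h₁).trans
        (ι_map_cotensorMap hEV hBV (creates hEV) (creates hBV) (𝟙 V) p)
    · exact (congrArg (IsGroupoidal K).ι.map h₂).trans
        (ι_map_cotensorMap hEV hEU (creates hEV) hEU' i (𝟙 _))
  isofib_sHom X _ _ p hp := hK.isofib_sHom X.obj _ hp

end IsInfinityCosmos

end InfCosmos

theorem mainTheorem10 (K : Type u) [Category.{v} K] [SimplicialCategory K]
    (isofib : MorphismProperty K) (hK : InfCosmos.IsInfinityCosmos K isofib) :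
    (∀ E : K, List.TFAE [
      -- every 2-cell with codomain `E` in the homotopy 2-category is invertible
      InfCosmos.IsGroupoidal K E,
      -- all hom-categories into `E` are groupoids
      ∀ X : K, IsGroupoid (SSet.hoFunctor.obj (sHom X E)),
      -- all functor spaces into `E` are Kan complexes
      ∀ X : K, SSet.KanComplex (sHom X E),
      -- the canonical map from `E ^ 𝕀` to `E ^ 𝟚` is a trivial fibration
      ∀ (EI E2 : K) (η : SSet.coherentIso.{v} ⟶ sHom EI E) (θ : Δ[1] ⟶ sHom E2 E)
        (hη : InfCosmos.IsCotensor η) (hθ : InfCosmos.IsCotensor θ),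
        InfCosmos.IsTrivialFibration isofib (hη.map hθ InfCosmos.arrowToIso (𝟙 E))]) ∧
    -- the full simplicial subcategory of groupoidal objects is an ∞-cosmos
    InfCosmos.IsInfinityCosmos (InfCosmos.GroupoidalObjects K)
      (isofib.inverseImage (InfCosmos.IsGroupoidal K).ι) ∧
    -- with limits, equivalences and trivial fibrations created by the inclusion
    InfCosmos.CreatesCosmologicalLimits (InfCosmos.IsGroupoidal K) isofib ∧
    (∀ (A B : InfCosmos.GroupoidalObjects K) (f : A ⟶ B),
      InfCosmos.IsEquivalence f ↔ InfCosmos.IsEquivalence ((InfCosmos.IsGroupoidal K).ι.map f)) ∧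
    (∀ (A B : InfCosmos.GroupoidalObjects K) (f : A ⟶ B),
      InfCosmos.IsTrivialFibration (isofib.inverseImage (InfCosmos.IsGroupoidal K).ι) f ↔
        InfCosmos.IsTrivialFibration isofib ((InfCosmos.IsGroupoidal K).ι.map f)) ∧
    -- and with Kan complexes as functor spaces
    (∀ A B : InfCosmos.GroupoidalObjects K, SSet.KanComplex (sHom A B)) :=
  ⟨hK.isGroupoidal_tfae, hK.isInfinityCosmos_groupoidalObjects, hK.createsCosmologicalLimits,
    fun _ _ f ↦ hK.isEquivalence_iff f, fun _ _ f ↦ and_congr_right' (hK.isEquivalence_iff f),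
    fun A B ↦ hK.kanComplex_sHom A.obj B⟩
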